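/- **Conventions.** For a complex Banach space $E$ (below $E=X$ or $E=B(X)$) and $T\in B(E)$, write $N(T)$, $R(T)$ for null space and range, $\alpha(T)=\dim N(T)$, $\beta(T)=\dim E/R(T)$. $T$ is *bounded below* if $N(T)=0$ and $R(T)$ is closed; it is *upper semi-Fredholm* if $R(T)$ is closed and $\alpha(T)<\infty$, and then $\operatorname{ind}(T)=\alpha(T)-\beta(T)\in\mathbb Z\cup\{-\infty\}$. The ascent $\operatorname{asc}(T)$ is the least $n\ge 0$ with $N(T^n)=N(T^{n+1})$ ($\infty$ if there is none). $T$ is *upper semi B-Fredholm* if for some $n\ge 0$ the range $R(T^n)$ is closed and the operator $T_n$ induced by $T$ on $R(T^n)$ is upper semi-Fredholm; $\operatorname{ind}(T)=\operatorname{ind}(T_n)$ for any such $n$. Put - $\sigma_a(T)=\{\lambda\in\mathbb C: T-\lambda \text{ is not bounded below}\}$ and $\sigma_s(T)=\{\lambda: R(T-\lambda)\ne E\}$; - $\sigma_{SF_+}(T)=\{\lambda: T-\lambda\text{ is not upper semi-Fredholm}\}$; - $\sigma_{aw}(T)=\{\lambda\in\sigma_a(T): T-\lambda\text{ is not upper semi-Fredholm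 or }\operatorname{ind}(T-\lambda)>0\}$; - $\sigma_{ab}(T)=\{\lambda\in\sigma_a(T): \lambda\in\sigma_{aw}(T)\text{ or }\operatorname{asc}(T-\lambda)=\infty\}$; - $\sigma_{SBF_+^-}(T)=\{\lambda: T-\lambda\text{ is not upper semi B-Fredholm or }\operatorname{ind}(T-\lambda)>0\}$; - $\Pi^a(T)$, the set of isolated points $\lambda$ of $\sigma_a(T)$ such that $a=\operatorname{asc}(T-\lambda)<\infty$ and $R((T-\lambda)^{a+1})$ is closed, and $\Pi^a_0(T)=\{\lambda\in\Pi^a(T):\alpha(T-\lambda)<\infty\}$. $T$ *satisfies $a$-Browder's theorem* ($a$-$Bt$) if $\sigma_{aw}(T)=\sigma_a(T)\setminus\Pi^a_0(T)$. For $A\in B(X)$, the operators $L_A,R_A\in B(B(X))$ are $L_A(S)=AS$ and $R_A(S)=SA$. **Theorem 3.7.** Let $X$ be an infinite-dimensional complex Banach space and $A\in B(X)$. (i) $L_A$ and $R_A$ satisfy $a$-$Bt$; indeed $$\sigma_{SF_+}(L_A)=\sigma_{aw}(L_A)=\sigma_{ab}(L_A)=\sigma_a(L_A)=\sigma_a(A),$$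 $$\sigma_{SF_+}(R_A)=\sigma_{aw}(R_A)=\sigma_{ab}(R_A)=\sigma_a(R_A)=\sigma_s(A).$$ (ii) $A$ satisfies $a$-$Bt$ and $\Pi^a(A)=\Pi^a(L_A)$ if and only if $\sigma_{SBF_+^-}(A)=\sigma_{SBF_+^-}(L_A)$. (iii) If $X$ is an infinite-dimensional complex Hilbert space and $A^*$ is the Hilbert space adjoint of $A$, then $A^*$ satisfies $a$-$Bt$ if and only if $\sigma_{SBF_+^-}(A^*)=\{\bar\lambda:\lambda\in\sigma_{SBF_+^-}(R_A)\}$. -/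

import Mathlib

open scoped ENNReal

namespace BrowderTheory

noncomputable section

section Operators

variable {E : Type*} [NormedAddCommGroup E] [NormedSpace ℂ E]

/-- The operator `T - z I`. -/
def shift (T : E →L[ℂ] E) (z : ℂ) : E →L[ℂ] E := T - z • (1 : E →L[ℂ] E)

/-- The null space `N(T)`. -/
def nullSpace (T : E →L[ℂ] E) : Submodule ℂ E := LinearMap.ker (T : E →ₗ[ℂ] E)

/-- The range `R(T)`. -/
def rangeSpace (T : E →L[ℂ] E) : Submodule ℂ E := LinearMap.range (T : E →ₗ[ℂ] E)

/-- `T` is bounded below: trivial null space and closed range. -/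
def IsBoundedBelow (T : E →L[ℂ] E) : Prop :=
  nullSpace T = ⊥ ∧ IsClosed (rangeSpace T : Set E)

/-- The approximate point spectrum `σ_a(T)`. -/
def approxPointSpectrum (T : E →L[ℂ] E) : Set ℂ :=
  {z | ¬ IsBoundedBelow (shift T z)}

/-- The surjectivity spectrum `σ_s(T)`. -/
def surjectivitySpectrum (T : E →L[ℂ] E) : Set ℂ :=
  {z | rangeSpace (shift T z) ≠ ⊤}

/-- The nullity `α(T) = dim N(T)`, in `{0, 1, 2, …, ∞}`. -/
def nullity (T : E →L[ℂ] E) : ℕ∞ :=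
  Cardinal.toENat (Module.rank ℂ (nullSpace T))

/-- The defect `β(T) = dim E / R(T)`, in `{0, 1, 2, …, ∞}`. -/
def defect (T : E →L[ℂ] E) : ℕ∞ :=
  Cardinal.toENat (Module.rank ℂ (E ⧸ rangeSpace T))

/-- `T` is upper semi-Fredholm: closed range and finite-dimensional null space. -/
def IsUpperSemiFredholm (T : E →L[ℂ] E) : Prop :=
  IsClosed (rangeSpace T : Set E) ∧ nullity T < ⊤

/-- The index `ind(T) = α(T) - β(T)`, in the extended reals. It is used only where `α(T)` is
finite, so that the difference makes sense (it is `-∞` if `β(T)` is infinite). -/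
def index (T : E →L[ℂ] E) : EReal :=
  ((nullity T : ℝ≥0∞) : EReal) - ((defect T : ℝ≥0∞) : EReal)

/-- The upper semi-Fredholm spectrum `σ_{SF₊}(T)`. -/
def upperSemiFredholmSpectrum (T : E →L[ℂ] E) : Set ℂ :=
  {z | ¬ IsUpperSemiFredholm (shift T z)}

/-- The Weyl essential approximate point spectrum `σ_{aw}(T)`. -/
def weylApproxSpectrum (T : E →L[ℂ] E) : Set ℂ :=
  {z ∈ approxPointSpectrum T |
    ¬ IsUpperSemiFredholm (shift T z) ∨ 0 < index (shift T z)}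

/-- The ascent of `T`: the least `n` with `N(Tⁿ) = N(Tⁿ⁺¹)`, and `∞` if there is none. -/
def ascent (T : E →L[ℂ] E) : ℕ∞ :=
  ⨅ n ∈ {n : ℕ | nullSpace (T ^ n) = nullSpace (T ^ (n + 1))}, (n : ℕ∞)

/-- The Browder essential approximate point spectrum `σ_{ab}(T)`. -/
def browderApproxSpectrum (T : E →L[ℂ] E) : Set ℂ :=
  {z ∈ approxPointSpectrum T | z ∈ weylApproxSpectrum T ∨ ascent (shift T z) = ⊤}

/-- The range of `Tⁿ` is invariant under `T`. -/
theorem map_mem_rangeSpace_pow (T : E →L[ℂ] E) (n : ℕ) (x : rangeSpace (T ^ n)) :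
    T x ∈ rangeSpace (T ^ n) := by
  obtain ⟨x, y, rfl⟩ := x
  refine ⟨T y, ?_⟩
  change (T ^ n * T) y = (T * T ^ n) y
  rw [← pow_succ, ← pow_succ']

/-- The operator `T_n` that `T` induces on the normed space `R(Tⁿ)`. -/
def inducedOnRange (T : E →L[ℂ] E) (n : ℕ) :
    rangeSpace (T ^ n) →L[ℂ] rangeSpace (T ^ n) :=
  (T.comp (rangeSpace (T ^ n)).subtypeL).codRestrict (rangeSpace (T ^ n))
    (map_mem_rangeSpace_pow T n)

/-- `T` is upper semi B-Fredholm, as witnessed by `n`: the range of `Tⁿ` is closed and the operator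
that `T` induces on it is upper semi-Fredholm. -/
def IsUpperSemiBFredholmAt (T : E →L[ℂ] E) (n : ℕ) : Prop :=
  IsClosed (rangeSpace (T ^ n) : Set E) ∧ IsUpperSemiFredholm (inducedOnRange T n)

/-- `σ_{SBF₊⁻}(T)`: the `z` for which `T - z` is not an upper semi B-Fredholm operator of index at
most `0`. The index of an upper semi B-Fredholm operator `S` is that of `S_n` for any `n` as in
`IsUpperSemiBFredholmAt` (all of them have the same index). -/
def upperSemiBWeylSpectrum (T : E →L[ℂ] E) : Set ℂ :=
  {z | ¬ ∃ n : ℕ, IsUpperSemiBFredholmAt (shift T z) n ∧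
    index (inducedOnRange (shift T z) n) ≤ 0}

/-- The isolated points of a set of complex numbers. -/
def isolatedPoints (K : Set ℂ) : Set ℂ :=
  {z ∈ K | ∃ ε > 0, ∀ w ∈ K, dist w z < ε → w = z}

/-- The left poles `Π^a(T)`. -/
def leftPoles (T : E →L[ℂ] E) : Set ℂ :=
  {z ∈ isolatedPoints (approxPointSpectrum T) |
    ∃ a : ℕ, ascent (shift T z) = a ∧ IsClosed (rangeSpace (shift T z ^ (a + 1)) : Set E)}

/-- The left poles of finite rank `Π₀^a(T)`. -/
def finiteRankLeftPoles (T : E →L[ℂ] E) : Set ℂ :=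
  {z ∈ leftPoles T | nullity (shift T z) < ⊤}

/-- `a`-Browder's theorem holds for `T`. -/
def SatisfiesABrowder (T : E →L[ℂ] E) : Prop :=
  weylApproxSpectrum T = approxPointSpectrum T \ finiteRankLeftPoles T

/-- Left multiplication `L_A : B(E) → B(E)`, `L_A(S) = AS`. -/
def leftMul (A : E →L[ℂ] E) : (E →L[ℂ] E) →L[ℂ] (E →L[ℂ] E) :=
  ContinuousLinearMap.mul ℂ (E →L[ℂ] E) A

/-- Right multiplication `R_A : B(E) → B(E)`, `R_A(S) = SA`. -/
def rightMul (A : E →L[ℂ] E) : (E →L[ℂ] E) →L[ℂ] (E →L[ℂ] E) :=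
  (ContinuousLinearMap.mul ℂ (E →L[ℂ] E)).flip A

end Operators

end

end BrowderTheory

open BrowderTheory

/-!
The proof rests on one description of left poles and on one equivalence.

Call `S` left Drazin invertible if, for some `n`, the ranges of `Sⁿ` and `Sⁿ⁺¹` are closed and `S`
is injective on `R(Sⁿ)` (`IsLeftDrazinAt`). The open mapping theorem makes `S` bounded below on
`R(Sⁿ)`, whence `S - w` is bounded below for all small `w ≠ 0`, and closedness of `R(Sᵐ)` descends
to every `m` not below the ascent. So the left poles of `T` are exactly the points `z` of `σ_a(T)`
at which `T - z` is left Drazin invertible (`mem_leftPoles_iff`): that they are isolated is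
automatic.

On a Banach space, `a`-Browder's theorem for `T` is equivalent to its B-Fredholm version
`σ_{SBF₊⁻}(T) = σ_a(T) \ Π^a(T)` (`satisfiesABrowder_iff`). Let `S = T - z` be upper semi B-Fredholm
at `n` with index at most `0`, and let `U` be the operator it induces on `R(Sⁿ)`. Two facts are used.

* If `N(U)` meets the range of every power of `U`, then `U` maps `⋂ R(Uᵏ)` onto itself with a
  nontrivial null space, and the geometric series built from preimages gives an eigenvector for
  every number near `0`. So either `S` is left Drazin invertible, or all points near `z` are
  eigenvalues of `T` (`IsUpperSemiBFredholmAt.eventually_nullSpace_ne_bot`).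
* `U` is a finite-rank perturbation of an operator that is bounded below, and this property is
  stable under small shifts. As a finite-rank perturbation of an injective operator has nullity at
  most its defect, `U - w`, and with it `S - w`, is upper semi-Fredholm of index at most `0` for
  small `w ≠ 0` (`IsUpperSemiBFredholmAt.eventually_shift`).

If `z` is not a left pole, both facts together put finite-rank left poles, which are isolated in
`σ_a(T)`, among a whole neighbourhood of eigenvalues. Part (ii) follows by comparing the two
B-Weyl spectra with the common set `σ_a(A) = σ_a(L_A)`.

For part (i), rank-one operators show that the null spaces of `L_B` and `R_B` are zero or
infinite-dimensional, so that "upper semi-Fredholm" and "bounded below" coincide for `L_A - z` and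
`R_A - z`. Rank-one operators and the Hahn-Banach theorem identify `L_B` bounded below with `B`
bounded below, and `R_B` bounded below with `B` surjective.

For part (iii), `S ↦ S*` carries `R_B` to `L_{B*}` and preserves left Drazin invertibility, so
`σ_{SBF₊⁻}(R_A)` is the conjugate of `σ_{SBF₊⁻}(L_{A*})`. On a Hilbert space `R(L_C)` is closed
exactly when `R(C)` is, hence `Π^a(A*) = Π^a(L_{A*})`, and part (ii) for `A*` gives the claim.
-/

namespace BrowderTheory

/-! ### Bounded below and upper semi-Fredholm operators -/

section Basics

variable {E : Type*} [NormedAddCommGroup E] [NormedSpace ℂ E]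

@[simp] theorem mem_nullSpace {T : E →L[ℂ] E} {x : E} : x ∈ nullSpace T ↔ T x = 0 := Iff.rfl

@[simp] theorem shift_apply (T : E →L[ℂ] E) (z : ℂ) (x : E) : shift T z x = T x - z • x := rfl

theorem shift_shift (T : E →L[ℂ] E) (z w : ℂ) : shift (shift T z) w = shift T (z + w) := by
  ext x; simp only [shift_apply, add_smul]; abel

theorem nullSpace_eq_bot {T : E →L[ℂ] E} : nullSpace T = ⊥ ↔ Function.Injective T :=
  LinearMap.ker_eq_bot

theorem isBoundedBelow_iff [CompleteSpace E] {T : E →L[ℂ] E} :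
    IsBoundedBelow T ↔ ∃ c > 0, ∀ x, c * ‖x‖ ≤ ‖T x‖ := by
  constructor
  · rintro ⟨h, h'⟩
    rw [nullSpace_eq_bot] at h
    obtain ⟨K, hK⟩ := T.antilipschitz_of_injective_of_isClosed_range h h'
    refine ⟨(K + 1 : ℝ)⁻¹, by positivity, fun x => ?_⟩
    have h1 := T.bound_of_antilipschitz hK x
    rw [inv_mul_le_iff₀ (by positivity)]
    nlinarith [norm_nonneg (T x)]
  · rintro ⟨c, hc, h⟩
    have hK : AntilipschitzWith (Real.toNNReal c⁻¹) T := by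
      refine T.antilipschitz_of_bound fun x => ?_
      rw [Real.coe_toNNReal _ (by positivity), inv_mul_eq_div, le_div_iff₀ hc, mul_comm]
      exact h x
    exact ⟨nullSpace_eq_bot.2 hK.injective, hK.isClosed_range T.uniformContinuous⟩

theorem nullity_lt_top {T : E →L[ℂ] E} :
    nullity T < ⊤ ↔ FiniteDimensional ℂ (nullSpace T) := by
  rw [nullity, Cardinal.toENat_lt_top, Module.rank_lt_aleph0_iff]

theorem isUpperSemiFredholm_def {T : E →L[ℂ] E} : IsUpperSemiFredholm T ↔
    IsClosed (rangeSpace T : Set E) ∧ FiniteDimensional ℂ (nullSpace T) := by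
  rw [IsUpperSemiFredholm, nullity_lt_top]

theorem index_nonpos_iff {T : E →L[ℂ] E} (h : nullity T < ⊤) :
    index T ≤ 0 ↔ nullity T ≤ defect T := by
  unfold index
  generalize nullity T = a at *
  generalize defect T = b
  lift a to ℕ using h.ne
  induction b with
  | top => simp
  | coe b =>
    have h1 : (((((a : ℕ∞) : ℝ≥0∞) : EReal)) - ((((b : ℕ∞) : ℝ≥0∞) : EReal))) =
        (((a : ℝ) - (b : ℝ) : ℝ) : EReal) := by
      push_cast
      rfl
    rw [h1, ← EReal.coe_zero, EReal.coe_le_coe_iff, sub_nonpos]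
    norm_cast

theorem IsBoundedBelow.nullity_eq_zero {T : E →L[ℂ] E} (h : IsBoundedBelow T) :
    nullity T = 0 := by
  rw [nullity, h.1]; simp

theorem IsBoundedBelow.isUpperSemiFredholm {T : E →L[ℂ] E} (h : IsBoundedBelow T) :
    IsUpperSemiFredholm T := ⟨h.2, by simp [h.nullity_eq_zero]⟩

theorem IsBoundedBelow.index_nonpos {T : E →L[ℂ] E} (h : IsBoundedBelow T) :
    index T ≤ 0 := by
  rw [index_nonpos_iff h.isUpperSemiFredholm.2, h.nullity_eq_zero]; simp

/-- An operator that is bounded below up to a finite-rank operator `F` is upper semi-Fredholm: it is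
bounded below on the closed subspace `ker F` of finite codimension. -/
theorem isUpperSemiFredholm_of_bound [CompleteSpace E] {T : E →L[ℂ] E}
    {G : Type*} [NormedAddCommGroup G] [NormedSpace ℂ G] [FiniteDimensional ℂ G]
    (F : E →L[ℂ] G) {a b c : ℝ} (hc : 0 < c)
    (h : ∀ x, c * ‖x‖ ≤ a * ‖T x‖ + b * ‖F x‖) :
    IsUpperSemiFredholm T := by
  rw [isUpperSemiFredholm_def]
  constructor
  · let K := LinearMap.ker (F : E →ₗ[ℂ] G)
    have hK : IsClosed (K : Set E) := F.isClosed_ker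
    have : CompleteSpace K := hK.completeSpace_coe
    have hco : K.CoFG := by
      have : FiniteDimensional ℂ (E ⧸ K) :=
        Module.Finite.equiv (LinearMap.quotKerEquivRange (F : E →ₗ[ℂ] G)).symm
      exact this
    have hanti : AntilipschitzWith (Real.toNNReal (|a| / c)) (T.comp K.subtypeL) := by
      refine ContinuousLinearMap.antilipschitz_of_bound _ fun x => ?_
      rw [Real.coe_toNNReal _ (by positivity), div_mul_eq_mul_div, le_div_iff₀ hc, mul_comm]
      have h1 := h x
      have h2 : F x = 0 := x.2
      rw [h2, norm_zero, mul_zero, add_zero] at h1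
      exact h1.trans (mul_le_mul_of_nonneg_right (le_abs_self a) (norm_nonneg _))
    refine LinearMap.isClosed_range_of_isClosed_map_of_finiteDimensional_quotient
      (f := (T : E →ₗ[ℂ] E)) (s := K) ?_
    have h2 := hanti.isClosed_range (T.comp K.subtypeL).uniformContinuous
    convert h2 using 1
    ext y
    simp
  · let f : nullSpace T →ₗ[ℂ] G := (F : E →ₗ[ℂ] G) ∘ₗ (nullSpace T).subtype
    refine FiniteDimensional.of_injective f ((injective_iff_map_eq_zero f).2 fun x hx => ?_)
    have h1 := h x
    have h2 : T x = 0 := x.2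
    have h3 : F x = 0 := hx
    rw [h2, h3, norm_zero, norm_zero, mul_zero, mul_zero, add_zero] at h1
    have : ‖(x : E)‖ ≤ 0 := by nlinarith
    exact Subtype.ext (norm_le_zero_iff.1 this)

/-- Converse of `isUpperSemiFredholm_of_bound`, with a projection onto the null space as the
finite-rank operator. -/
theorem IsUpperSemiFredholm.exists_bound [CompleteSpace E] {T : E →L[ℂ] E}
    (hT : IsUpperSemiFredholm T) :
    ∃ P : E →L[ℂ] nullSpace T, (∀ x : nullSpace T, P x = x) ∧
      ∃ c > 0, ∀ x, c * ‖x‖ ≤ ‖T x‖ + ‖P x‖ := by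
  obtain ⟨hcl, hfin⟩ := isUpperSemiFredholm_def.1 hT
  obtain ⟨P, hP⟩ := Submodule.ClosedComplemented.of_finiteDimensional (𝕜 := ℂ) (nullSpace T)
  refine ⟨P, hP, ?_⟩
  let K := LinearMap.ker (P : E →ₗ[ℂ] nullSpace T)
  have hK : IsClosed (K : Set E) := P.isClosed_ker
  have : CompleteSpace K := hK.completeSpace_coe
  have hsub : ∀ x, x - (P x : E) ∈ K := fun x => by
    change P (x - (P x : E)) = 0
    rw [map_sub, hP, sub_self]
  have hker : ∀ x, T (P x : E) = 0 := fun x => (P x).2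
  have hinj : Function.Injective (T.comp K.subtypeL) := by
    rw [injective_iff_map_eq_zero]
    intro x hx
    have h2 : P x = 0 := x.2
    have h3 := hP ⟨x, hx⟩
    exact Subtype.ext (by simpa [h2] using congrArg Subtype.val h3.symm)
  have hran : Set.range (T.comp K.subtypeL) = rangeSpace T := by
    ext y
    constructor
    · rintro ⟨x, rfl⟩; exact ⟨x, rfl⟩
    · rintro ⟨x, rfl⟩
      exact ⟨⟨_, hsub x⟩, by simp [hker]⟩
  obtain ⟨C, hC⟩ := (T.comp K.subtypeL).antilipschitz_of_injective_of_isClosed_range hinj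
    (hran ▸ hcl)
  refine ⟨(C + 1 : ℝ)⁻¹, by positivity, fun x => ?_⟩
  have h1 := ContinuousLinearMap.bound_of_antilipschitz _ hC ⟨_, hsub x⟩
  have h2 : ‖x - (P x : E)‖ ≤ C * ‖T x‖ := by simpa [hker] using h1
  have h3 : ‖x‖ ≤ ‖x - (P x : E)‖ + ‖P x‖ := by
    simpa using norm_add_le (x - (P x : E)) (P x : E)
  rw [inv_mul_le_iff₀ (by positivity)]
  nlinarith [norm_nonneg (T x), norm_nonneg (P x), C.2, mul_nonneg C.2 (norm_nonneg (P x))]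

theorem IsUpperSemiFredholm.pow [CompleteSpace E] {T : E →L[ℂ] E}
    (hT : IsUpperSemiFredholm T) (k : ℕ) : IsUpperSemiFredholm (T ^ k) := by
  induction k with
  | zero =>
    refine IsBoundedBelow.isUpperSemiFredholm (isBoundedBelow_iff.2 ⟨1, one_pos, fun x => ?_⟩)
    simp
  | succ k ih =>
    have := (isUpperSemiFredholm_def.1 hT).2
    have := (isUpperSemiFredholm_def.1 ih).2
    obtain ⟨P, -, c, hc, h⟩ := hT.exists_bound
    obtain ⟨Q, -, d, hd, h'⟩ := ih.exists_bound
    refine isUpperSemiFredholm_of_bound ((Q.comp T).prod P) (a := 1) (b := 1 + d)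
      (mul_pos hd hc) fun x => ?_
    have e : (T ^ (k + 1)) x = (T ^ k) (T x) := by rw [pow_succ]; rfl
    have h1 := h' (T x)
    have h2 := h x
    have h3 : ‖Q (T x)‖ ≤ ‖((Q.comp T).prod P) x‖ := le_max_left _ _
    have h4 : ‖P x‖ ≤ ‖((Q.comp T).prod P) x‖ := le_max_right _ _
    rw [e]
    nlinarith

theorem IsUpperSemiFredholm.of_pow [CompleteSpace E] {T : E →L[ℂ] E} {k : ℕ}
    (hT : IsUpperSemiFredholm (T ^ (k + 1))) : IsUpperSemiFredholm T := by
  have := (isUpperSemiFredholm_def.1 hT).2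
  obtain ⟨P, -, c, hc, h⟩ := hT.exists_bound
  refine isUpperSemiFredholm_of_bound P (a := ‖T ^ k‖) (b := 1) hc fun x => ?_
  have e : (T ^ (k + 1)) x = (T ^ k) (T x) := by rw [pow_succ]; rfl
  have h1 := h x
  have h2 := (T ^ k).le_opNorm (T x)
  rw [e] at h1
  linarith

end Basics

/-! ### Nullity and defect in linear algebra -/

section LinearAlgebra

variable {K M : Type*} [Field K] [AddCommGroup M] [Module K M]

/-- A finite-rank perturbation `U` of an injective endomorphism `V` has nullity at most its defect.
The two maps agree on `L = ker (V - U)`, so both induce maps from the finite-dimensional `M / L` to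
`M / V(L)`; that of `V` is injective, which bounds the dimensions for that of `U`. -/
theorem finrank_ker_le_of_finiteDimensional_range_sub (V U : M →ₗ[K] M)
    (hV : Function.Injective V) [FiniteDimensional K (LinearMap.range (V - U))]
    [FiniteDimensional K (M ⧸ LinearMap.range U)] :
    Module.finrank K (LinearMap.ker U) ≤ Module.finrank K (M ⧸ LinearMap.range U) := by
  let L := LinearMap.ker (V - U)
  have hL : ∀ x ∈ L, V x = U x := fun x hx => sub_eq_zero.1 hx
  have : FiniteDimensional K (M ⧸ L) :=
    Module.Finite.equiv (LinearMap.quotKerEquivRange (V - U)).symm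
  let W := L.map V
  let ψ : M ⧸ L →ₗ[K] M ⧸ W := L.mapQ W V (Submodule.le_comap_map V L)
  let φ : M ⧸ L →ₗ[K] M ⧸ W := L.mapQ W U fun x hx => ⟨x, hx, hL x hx⟩
  have hψ : Function.Injective ψ := by
    rw [injective_iff_map_eq_zero]
    intro q
    induction q using Submodule.Quotient.induction_on with
    | H x =>
      intro h
      have h1 : W.mkQ (V x) = 0 := h
      obtain ⟨y, hy, hyx⟩ : V x ∈ W := by simpa using h1
      rw [← hV hyx]
      exact (Submodule.Quotient.mk_eq_zero L).2 hy
  let κ : M ⧸ LinearMap.range U →ₗ[K] (M ⧸ W) ⧸ LinearMap.range φ :=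
    (LinearMap.range U).liftQ ((LinearMap.range φ).mkQ ∘ₗ W.mkQ) (by
      rintro _ ⟨x, rfl⟩
      exact (Submodule.Quotient.mk_eq_zero _).2 ⟨L.mkQ x, rfl⟩)
  have hκ : Function.Surjective κ := by
    intro q
    obtain ⟨q, rfl⟩ := (LinearMap.range φ).mkQ_surjective q
    obtain ⟨x, rfl⟩ := W.mkQ_surjective q
    exact ⟨(LinearMap.range U).mkQ x, rfl⟩
  have : FiniteDimensional K ((M ⧸ W) ⧸ LinearMap.range φ) := Module.Finite.of_surjective κ hκ
  have : FiniteDimensional K (M ⧸ W) := Module.Finite.of_submodule_quotient (LinearMap.range φ)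
  let θ : LinearMap.ker U →ₗ[K] LinearMap.ker φ :=
    (L.mkQ ∘ₗ (LinearMap.ker U).subtype).codRestrict _ fun x => by
      have : U x = 0 := x.2
      change W.mkQ (U x) = 0
      rw [this, map_zero]
  have hθ : Function.Injective θ := by
    rw [injective_iff_map_eq_zero]
    intro x hx
    have h1 : L.mkQ x = 0 := congrArg Subtype.val hx
    have h2 : (x : M) ∈ L := by simpa using h1
    have h3 : V x = 0 := (hL x h2).trans x.2
    exact Subtype.ext (hV (h3.trans (map_zero V).symm))
  have e1 := LinearMap.finrank_le_finrank_of_injective hθ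
  have e2 := LinearMap.finrank_le_finrank_of_injective hψ
  have e3 := LinearMap.finrank_le_finrank_of_surjective hκ
  have e4 := LinearMap.finrank_range_add_finrank_ker φ
  have e5 := Submodule.finrank_quotient_add_finrank (LinearMap.range φ)
  omega

/-- An endomorphism `T` of finite ascent `a` and finite nullity has nullity at most its defect. On
the finite-dimensional `N = ker Tᵃ` nullity and defect agree, and `N / T(N)` embeds in `M / T(M)`
because `T x ∈ N` only for `x ∈ N`. -/
theorem finrank_ker_le_of_ker_pow_eq (T : M →ₗ[K] M) (a : ℕ)
    (h : LinearMap.ker (T ^ a) = LinearMap.ker (T ^ (a + 1)))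
    [FiniteDimensional K (LinearMap.ker (T ^ a))] [FiniteDimensional K (M ⧸ LinearMap.range T)] :
    Module.finrank K (LinearMap.ker T) ≤ Module.finrank K (M ⧸ LinearMap.range T) := by
  let N := LinearMap.ker (T ^ a)
  have hmem : ∀ x, T x ∈ N ↔ x ∈ N := fun x => by
    change _ ↔ x ∈ LinearMap.ker (T ^ a)
    rw [h, pow_succ]
    rfl
  let t : N →ₗ[K] N := T.restrict fun x hx => (hmem x).2 hx
  let θ : LinearMap.ker T →ₗ[K] LinearMap.ker t :=
    LinearMap.codRestrict _ ((LinearMap.ker T).subtype.codRestrict N fun x =>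
      (hmem x).1 (by
        have : T x = 0 := x.2
        change T x ∈ N
        rw [this]; exact N.zero_mem)) fun x => Subtype.ext x.2
  have hθ : Function.Injective θ := fun x y hxy =>
    Subtype.ext (congrArg (fun v : LinearMap.ker t => ((v : N) : M)) hxy)
  let κ : N ⧸ LinearMap.range t →ₗ[K] M ⧸ LinearMap.range T :=
    Submodule.mapQ _ _ N.subtype (by rintro _ ⟨x, rfl⟩; exact ⟨x, rfl⟩)
  have hκ : Function.Injective κ := by
    rw [injective_iff_map_eq_zero]
    intro q
    induction q using Submodule.Quotient.induction_on with
    | H x =>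
      intro hx
      have h1 : (LinearMap.range T).mkQ x = 0 := hx
      obtain ⟨y, hy⟩ : (x : M) ∈ LinearMap.range T := by simpa using h1
      have hyN : y ∈ N := (hmem y).1 (hy ▸ x.2)
      exact (Submodule.Quotient.mk_eq_zero _).2 ⟨⟨y, hyN⟩, Subtype.ext hy⟩
  have e1 := LinearMap.finrank_le_finrank_of_injective hθ
  have e2 := LinearMap.finrank_le_finrank_of_injective hκ
  have e3 := LinearMap.finrank_range_add_finrank_ker t
  have e4 := Submodule.finrank_quotient_add_finrank (LinearMap.range t)
  omega

end LinearAlgebra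

/-! ### Small shifts of upper semi-Fredholm operators -/

section Perturbation

variable {E : Type*} [NormedAddCommGroup E] [NormedSpace ℂ E]

theorem nullity_le_defect_of_finrank {T : E →L[ℂ] E} (hT : nullity T < ⊤)
    (h : FiniteDimensional ℂ (E ⧸ rangeSpace T) →
      Module.finrank ℂ (nullSpace T) ≤ Module.finrank ℂ (E ⧸ rangeSpace T)) :
    nullity T ≤ defect T := by
  have := nullity_lt_top.1 hT
  by_cases hfin : FiniteDimensional ℂ (E ⧸ rangeSpace T)
  · rw [nullity, defect, ← Module.finrank_eq_rank, ← Module.finrank_eq_rank]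
    simpa only [Cardinal.toENat_nat, Nat.cast_le, map_natCast] using h hfin
  · have : defect T = ⊤ := by
      rw [defect, Cardinal.toENat_eq_top, ← not_lt, Module.rank_lt_aleph0_iff]
      exact hfin
    rw [this]; exact le_top

theorem rangeSpace_pow_antitone (T : E →L[ℂ] E) : Antitone fun k => rangeSpace (T ^ k) := by
  intro k l hkl
  obtain ⟨m, rfl⟩ := Nat.exists_eq_add_of_le hkl
  rintro _ ⟨x, rfl⟩
  exact ⟨(T ^ m) x, by rw [pow_add]; rfl⟩

theorem pow_succ_apply (T : E →L[ℂ] E) (k : ℕ) (x : E) : (T ^ (k + 1)) x = (T ^ k) (T x) := by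
  rw [pow_succ]; rfl

theorem pow_succ_apply' (T : E →L[ℂ] E) (k : ℕ) (x : E) : (T ^ (k + 1)) x = T ((T ^ k) x) := by
  rw [pow_succ']; rfl

theorem norm_apply_le_norm_shift (T : E →L[ℂ] E) (z : ℂ) (x : E) : ‖T x‖ ≤ ‖shift T z x‖ + ‖z‖ * ‖x‖ := by
  rw [← norm_smul]
  simpa using norm_add_le (shift T z x) (z • x)

/-- An upper semi-Fredholm operator of nonpositive index is a finite-rank perturbation of an
operator that is bounded below: map the null space injectively into a complement of the range. -/
theorem IsUpperSemiFredholm.exists_isBoundedBelow_add [CompleteSpace E] {T : E →L[ℂ] E}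
    (hT : IsUpperSemiFredholm T) (hd : nullity T ≤ defect T) :
    ∃ (P : E →L[ℂ] nullSpace T) (j : nullSpace T →L[ℂ] E),
      IsBoundedBelow (T + j.comp P) := by
  obtain ⟨P, hP, c, hc, h⟩ := hT.exists_bound
  have hfin := (isUpperSemiFredholm_def.1 hT).2
  have hrank : Module.rank ℂ (nullSpace T) ≤ Module.rank ℂ (E ⧸ rangeSpace T) := by
    refine (Cardinal.toENat_le_iff_of_le_aleph0 ?_).1 hd
    exact (Module.rank_lt_aleph0_iff.2 hfin).le
  obtain ⟨i, hi⟩ := rank_le_iff_exists_linearMap.1 hrank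
  obtain ⟨s, hs⟩ := (rangeSpace T).mkQ.exists_rightInverse_of_surjective
    (LinearMap.range_eq_top.2 (rangeSpace T).mkQ_surjective)
  let j : nullSpace T →L[ℂ] E := LinearMap.toContinuousLinearMap (s ∘ₗ i)
  have hj : ∀ n, (rangeSpace T).mkQ (j n) = i n := fun n => LinearMap.congr_fun hs (i n)
  refine ⟨P, j, nullSpace_eq_bot.2 ((injective_iff_map_eq_zero _).2 fun x hx => ?_), ?_⟩
  · have hx : T x + j (P x) = 0 := hx
    have h1 : (rangeSpace T).mkQ (T x + j (P x)) = i (P x) := by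
      have h2 : (rangeSpace T).mkQ (T x) = 0 :=
        (Submodule.Quotient.mk_eq_zero (rangeSpace T)).2 ⟨x, rfl⟩
      rw [map_add, hj, h2, zero_add]
    rw [hx, map_zero] at h1
    have h2 : P x = 0 := hi (h1.symm.trans (map_zero i).symm)
    rw [h2, map_zero, add_zero] at hx
    have h3 := hP ⟨x, hx⟩
    rw [h2] at h3
    exact (congrArg Subtype.val h3).symm
  · refine (isUpperSemiFredholm_of_bound P (a := 1) (b := 1 + ‖j‖) hc fun x => ?_).1
    have h1 : ‖T x‖ ≤ ‖(T + j.comp P) x‖ + ‖j (P x)‖ := by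
      simpa using norm_sub_le ((T + j.comp P) x) (j (P x))
    have h2 := j.le_opNorm (P x)
    have h3 := h x
    linarith

theorem IsBoundedBelow.eventually_shift [CompleteSpace E] {T : E →L[ℂ] E}
    (hT : IsBoundedBelow T) : ∃ ε > 0, ∀ w : ℂ, ‖w‖ < ε → IsBoundedBelow (shift T w) := by
  obtain ⟨c, hc, h⟩ := isBoundedBelow_iff.1 hT
  refine ⟨c, hc, fun w hw => isBoundedBelow_iff.2 ⟨c - ‖w‖, by linarith, fun x => ?_⟩⟩
  have := h x
  have := norm_apply_le_norm_shift T w x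
  linarith

/-- Upper semi-Fredholm operators of nonpositive index are stable under small shifts. -/
theorem IsUpperSemiFredholm.eventually_shift [CompleteSpace E] {T : E →L[ℂ] E}
    (hT : IsUpperSemiFredholm T) (hd : nullity T ≤ defect T) :
    ∃ ε > 0, ∀ w : ℂ, ‖w‖ < ε →
      IsUpperSemiFredholm (shift T w) ∧ nullity (shift T w) ≤ defect (shift T w) := by
  obtain ⟨P, j, hV⟩ := hT.exists_isBoundedBelow_add hd
  have hfin := (isUpperSemiFredholm_def.1 hT).2
  obtain ⟨ε, hε, h⟩ := hV.eventually_shift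
  refine ⟨ε, hε, fun w hw => ?_⟩
  have hw := h w hw
  obtain ⟨c, hc, hb⟩ := isBoundedBelow_iff.1 hw
  have key : ∀ x, shift (T + j.comp P) w x = shift T w x + j (P x) := fun x => by
    simp only [shift_apply, add_apply, ContinuousLinearMap.comp_apply]; abel
  have hSF : IsUpperSemiFredholm (shift T w) := by
    refine isUpperSemiFredholm_of_bound P (a := 1) (b := ‖j‖) hc fun x => ?_
    have h1 := hb x
    rw [key] at h1
    have h2 := norm_add_le (shift T w x) (j (P x))
    have h3 := j.le_opNorm (P x)
    linarith
  refine ⟨hSF, nullity_le_defect_of_finrank hSF.2 fun hc => ?_⟩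
  change FiniteDimensional ℂ (E ⧸ LinearMap.range (shift T w : E →ₗ[ℂ] E)) at hc
  have hr : FiniteDimensional ℂ (LinearMap.range
      ((shift (T + j.comp P) w : E →ₗ[ℂ] E) - (shift T w : E →ₗ[ℂ] E))) := by
    have : (shift (T + j.comp P) w : E →ₗ[ℂ] E) - (shift T w : E →ₗ[ℂ] E) =
        (j : nullSpace T →ₗ[ℂ] E) ∘ₗ (P : E →ₗ[ℂ] nullSpace T) := by
      ext x
      have := key x
      simp only [LinearMap.sub_apply, LinearMap.comp_apply, ContinuousLinearMap.coe_coe, this]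
      abel
    rw [this]
    exact Submodule.finiteDimensional_of_le (LinearMap.range_comp_le_range _ _)
  exact finrank_ker_le_of_finiteDimensional_range_sub (shift (T + j.comp P) w : E →ₗ[ℂ] E)
    (shift T w : E →ₗ[ℂ] E) (nullSpace_eq_bot.1 hw.1)

end Perturbation

/-! ### Eigenvalues near zero -/

section Eigenvectors

variable {E : Type*} [NormedAddCommGroup E] [NormedSpace ℂ E] [CompleteSpace E]

/-- Every number near `0` is an eigenvalue of a surjective operator that is not injective: if
`T xₖ₊₁ = xₖ` and `T x₀ = 0` then `∑ wᵏ xₖ` is an eigenvector for `w`. -/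
theorem exists_eigenvector_of_surjective {T : E →L[ℂ] E} (hT : Function.Surjective T) {x₀ : E}
    (h0 : x₀ ≠ 0) (hx₀ : T x₀ = 0) :
    ∃ ε > 0, ∀ w : ℂ, ‖w‖ < ε → ∃ y, y ≠ 0 ∧ T y = w • y := by
  obtain ⟨C, hC, h⟩ := T.exists_preimage_norm_le hT
  choose g hg hgn using h
  refine ⟨(2 * C)⁻¹, by positivity, fun w hw => ?_⟩
  let x : ℕ → E := fun k => g^[k] x₀
  have hx : ∀ k, T (x (k + 1)) = x k := fun k => by
    simp only [x, Function.iterate_succ_apply']; exact hg _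
  have hn : ∀ k, ‖x k‖ ≤ C ^ k * ‖x₀‖ := fun k => by
    induction k with
    | zero => simp [x]
    | succ k ih =>
      have : x (k + 1) = g (x k) := Function.iterate_succ_apply' _ _ _
      rw [this, pow_succ', mul_assoc]
      exact (hgn _).trans (mul_le_mul_of_nonneg_left ih hC.le)
  set r := ‖w‖ * C with hr
  have hr0 : 0 ≤ r := by positivity
  have hr2 : r < 1 / 2 := by
    have := mul_lt_mul_of_pos_right hw hC
    rwa [mul_inv, mul_assoc, inv_mul_cancel₀ hC.ne', mul_one, ← one_div] at this
  have hb : ∀ k, ‖w ^ k • x k‖ ≤ r ^ k * ‖x₀‖ := fun k => by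
    rw [norm_smul, norm_pow, hr, mul_pow, mul_assoc]
    exact mul_le_mul_of_nonneg_left (hn k) (by positivity)
  have hsr : Summable fun k => r ^ k * ‖x₀‖ :=
    (summable_geometric_of_lt_one hr0 (by linarith)).mul_right _
  have hs : Summable fun k => w ^ k • x k := Summable.of_norm_bounded hsr hb
  have hs1 : Summable fun k => w ^ (k + 1) • x (k + 1) := (summable_nat_add_iff 1).2 hs
  have hsplit : ∑' k, w ^ k • x k = x₀ + ∑' k, w ^ (k + 1) • x (k + 1) := by
    rw [hs.tsum_eq_zero_add]; simp [x]
  refine ⟨∑' k, w ^ k • x k, fun hy => ?_, ?_⟩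
  · have h1 : ‖∑' k, w ^ (k + 1) • x (k + 1)‖ ≤ ∑' k : ℕ, r ^ (k + 1) * ‖x₀‖ :=
      tsum_of_norm_bounded ((summable_nat_add_iff 1).2 hsr).hasSum fun k => hb (k + 1)
    have h2 : ∑' k : ℕ, r ^ (k + 1) * ‖x₀‖ = r * (1 - r)⁻¹ * ‖x₀‖ := by
      rw [tsum_mul_right, ← tsum_geometric_of_lt_one hr0 (by linarith), ← tsum_mul_left]
      simp only [pow_succ']
    have h3 : x₀ = -∑' k, w ^ (k + 1) • x (k + 1) := by
      rw [hsplit] at hy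
      exact eq_neg_of_add_eq_zero_left hy
    have h4 : ‖x₀‖ = ‖∑' k, w ^ (k + 1) • x (k + 1)‖ := by 
      rw [← norm_neg (∑' k, w ^ (k + 1) • x (k + 1)), ← h3]
    have h5 : 0 < ‖x₀‖ := norm_pos_iff.2 h0
    have h6 : r * (1 - r)⁻¹ < 1 := by
      rw [← div_eq_mul_inv, div_lt_one (by linarith)]; linarith
    nlinarith
  · calc T (∑' k, w ^ k • x k) = T x₀ + ∑' k, T (w ^ (k + 1) • x (k + 1)) := by
          rw [hsplit, map_add, T.map_tsum hs1]
      _ = ∑' k, w • (w ^ k • x k) := by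
          rw [hx₀, zero_add]
          refine tsum_congr fun k => ?_
          rw [map_smul, hx, smul_smul, pow_succ']
      _ = w • ∑' k, w ^ k • x k := hs.tsum_const_smul w

/-- If the null space of an upper semi-Fredholm operator meets the range of each of its powers,
then all numbers near `0` are eigenvalues. -/
theorem IsUpperSemiFredholm.eventually_nullSpace_ne_bot {T : E →L[ℂ] E}
    (hT : IsUpperSemiFredholm T) (h : ∀ k, nullSpace T ⊓ rangeSpace (T ^ k) ≠ ⊥) :
    ∃ ε > 0, ∀ w : ℂ, ‖w‖ < ε → nullSpace (shift T w) ≠ ⊥ := by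
  have hfin := (isUpperSemiFredholm_def.1 hT).2
  -- The subspaces `N(T) ⊓ R(Tᵏ)` of the finite-dimensional `N(T)` decrease, so they stabilize.
  obtain ⟨k₀, hk₀⟩ := IsArtinian.monotone_stabilizes (R := ℂ) (M := nullSpace T)
    ⟨fun k => OrderDual.toDual ((rangeSpace (T ^ k)).comap (nullSpace T).subtype),
      fun k l hkl => Submodule.comap_mono (rangeSpace_pow_antitone T hkl)⟩
  have hstab : ∀ x, T x = 0 → x ∈ rangeSpace (T ^ k₀) → ∀ k, x ∈ rangeSpace (T ^ k) := by
    intro x hx hxk k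
    have h1 := hk₀ (max k₀ k) (le_max_left _ _)
    have h2 : (⟨x, hx⟩ : nullSpace T) ∈ (rangeSpace (T ^ k₀)).comap (nullSpace T).subtype := hxk
    have h1' : (rangeSpace (T ^ k₀)).comap (nullSpace T).subtype =
      (rangeSpace (T ^ max k₀ k)).comap (nullSpace T).subtype := h1
    rw [h1'] at h2
    exact rangeSpace_pow_antitone T (le_max_right k₀ k) h2
  let M : Submodule ℂ E := ⨅ k, rangeSpace (T ^ k)
  have hmem : ∀ x, x ∈ M ↔ ∀ k, x ∈ rangeSpace (T ^ k) := fun x => Submodule.mem_iInf _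
  have hMcl : IsClosed (M : Set E) := by
    rw [Submodule.coe_iInf]
    exact isClosed_iInter fun k => (hT.pow k).1
  have : CompleteSpace M := hMcl.completeSpace_coe
  have hmaps : ∀ x ∈ M, T x ∈ M := fun x hx => (hmem _).2 fun k =>
    map_mem_rangeSpace_pow T k ⟨x, (hmem x).1 hx k⟩
  let u : M →L[ℂ] M := (T.comp M.subtypeL).codRestrict M fun x => hmaps x x.2
  -- Two preimages of `x` in `R(T^k₀)` differ by a vector of `N(T) ⊓ R(T^k₀)`, which lies in every
  -- `R(Tᵏ)`; so if one preimage lies in `R(Tᵏ)`, then so does the other.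
  have hu : Function.Surjective u := by
    rintro ⟨x, hx⟩
    rw [hmem] at hx
    obtain ⟨v, hv⟩ := hx (k₀ + 1)
    have hv : T ((T ^ k₀) v) = x := by rw [← pow_succ_apply']; exact hv
    refine ⟨⟨(T ^ k₀) v, (hmem _).2 fun k => ?_⟩, Subtype.ext hv⟩
    obtain ⟨v', hv'⟩ := hx (max k₀ k + 1)
    have hv' : T ((T ^ max k₀ k) v') = x := by rw [← pow_succ_apply']; exact hv'
    have h1 := hstab ((T ^ k₀) v - (T ^ max k₀ k) v') (by rw [map_sub, hv, hv', sub_self])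
      (sub_mem ⟨v, rfl⟩ (rangeSpace_pow_antitone T (le_max_left k₀ k) ⟨v', rfl⟩)) k
    have h2 := add_mem h1 (rangeSpace_pow_antitone T (le_max_right k₀ k) ⟨v', rfl⟩)
    rwa [ContinuousLinearMap.coe_coe, sub_add_cancel] at h2
  obtain ⟨x₀, ⟨hx₀, hx₀'⟩, h0⟩ := Submodule.exists_mem_ne_zero_of_ne_bot (h k₀)
  obtain ⟨ε, hε, H⟩ := exists_eigenvector_of_surjective hu
    (x₀ := ⟨x₀, (hmem _).2 (hstab x₀ hx₀ hx₀')⟩) (fun h => h0 (congrArg Subtype.val h))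
    (Subtype.ext hx₀)
  refine ⟨ε, hε, fun w hw hbot => ?_⟩
  obtain ⟨y, hy0, hy⟩ := H w hw
  have h1 : (y : E) ∈ nullSpace (shift T w) := by
    rw [mem_nullSpace, shift_apply, sub_eq_zero]
    exact congrArg Subtype.val hy
  rw [hbot, Submodule.mem_bot] at h1
  exact hy0 (Subtype.ext h1)

end Eigenvectors

/-! ### Left Drazin invertibility and left poles -/

section LeftDrazin

variable {E : Type*} [NormedAddCommGroup E] [NormedSpace ℂ E]

/-- `T` is left Drazin invertible, as witnessed by `n`: the ranges of `Tⁿ` and `Tⁿ⁺¹` are closed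
and `T` is injective on the range of `Tⁿ`. -/
def IsLeftDrazinAt (T : E →L[ℂ] E) (n : ℕ) : Prop :=
  IsClosed (rangeSpace (T ^ n) : Set E) ∧ IsClosed (rangeSpace (T ^ (n + 1)) : Set E) ∧
    nullSpace T ⊓ rangeSpace (T ^ n) = ⊥

theorem nullSpace_pow_eq_iff {T : E →L[ℂ] E} {n : ℕ} :
    nullSpace (T ^ n) = nullSpace (T ^ (n + 1)) ↔ nullSpace T ⊓ rangeSpace (T ^ n) = ⊥ := by
  constructor
  · intro h
    rw [eq_bot_iff]
    rintro _ ⟨hx, y, rfl⟩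
    have h1 : y ∈ nullSpace (T ^ (n + 1)) := by
      rw [mem_nullSpace, pow_succ_apply']; exact hx
    rw [← h] at h1
    exact h1
  · intro h
    ext x
    simp only [mem_nullSpace]
    rw [pow_succ_apply']
    refine ⟨fun hx => by rw [hx, map_zero], fun hx => ?_⟩
    have h1 : (T ^ n) x ∈ nullSpace T ⊓ rangeSpace (T ^ n) := ⟨hx, x, rfl⟩
    rw [h] at h1
    exact h1

theorem nullSpace_inf_rangeSpace_mono {T : E →L[ℂ] E} {n m : ℕ} (hnm : n ≤ m)
    (h : nullSpace T ⊓ rangeSpace (T ^ n) = ⊥) : nullSpace T ⊓ rangeSpace (T ^ m) = ⊥ :=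
  eq_bot_mono (inf_le_inf_left _ (rangeSpace_pow_antitone T hnm)) h

theorem ascent_eq_coe_iff {T : E →L[ℂ] E} {a : ℕ} : ascent T = a ↔
    nullSpace T ⊓ rangeSpace (T ^ a) = ⊥ ∧
      ∀ n, nullSpace T ⊓ rangeSpace (T ^ n) = ⊥ → a ≤ n := by
  simp only [ascent, Set.mem_ofPred_eq, nullSpace_pow_eq_iff]
  constructor
  · intro h
    have hle : ∀ n, nullSpace T ⊓ rangeSpace (T ^ n) = ⊥ → a ≤ n := fun n hn => by
      have : (a : ℕ∞) ≤ n := h ▸ iInf₂_le n hn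
      exact_mod_cast this
    refine ⟨?_, hle⟩
    by_contra hne
    have h1 : ((a + 1 : ℕ) : ℕ∞) ≤ a := by
      conv_rhs => rw [← h]
      refine le_iInf₂ fun n hn => ?_
      have h2 := hle n hn
      have h3 : a ≠ n := fun e => hne (e ▸ hn)
      exact_mod_cast (by omega : a + 1 ≤ n)
    have : a + 1 ≤ a := by exact_mod_cast h1
    omega
  · rintro ⟨h1, h2⟩
    refine le_antisymm (iInf₂_le a h1) (le_iInf₂ fun n hn => ?_)
    exact_mod_cast h2 n hn

theorem isLeftDrazinAt_zero {T : E →L[ℂ] E} : IsLeftDrazinAt T 0 ↔ IsBoundedBelow T := by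
  have h : rangeSpace (T ^ 0) = ⊤ := LinearMap.range_eq_top.2 fun x => ⟨x, by simp⟩
  rw [IsLeftDrazinAt, h, inf_top_eq, zero_add, pow_one, IsBoundedBelow]
  simp [and_comm]

/-- `Tⁿ - zⁿ` is a left multiple of `T - z`. -/
theorem exists_mul_shift (T : E →L[ℂ] E) (z : ℂ) (n : ℕ) :
    ∃ Q : E →L[ℂ] E, Commute Q T ∧ T ^ n - z ^ n • 1 = Q * shift T z := by
  have hcomm : Commute T (z • (1 : E →L[ℂ] E)) := by
    rw [Commute, SemiconjBy, mul_smul_comm, smul_mul_assoc, mul_one, one_mul]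
  refine ⟨∑ i ∈ Finset.range n, T ^ i * (z • (1 : E →L[ℂ] E)) ^ (n - 1 - i), ?_, ?_⟩
  · exact Commute.sum_left _ _ _ fun i _ =>
      ((Commute.refl T).pow_left _).mul_left (hcomm.symm.pow_left _)
  · rw [shift, hcomm.geom_sum₂_mul, smul_pow, one_pow]

variable [CompleteSpace E]

/-- If `Tⁿ` and `Tⁿ⁺¹` have the same null space and `Tⁿ⁺¹` has closed range, then `T` is bounded
below on the range of `Tⁿ`, by the open mapping theorem for `Tⁿ⁺¹`. -/
theorem exists_bound_on_rangeSpace_pow {T : E →L[ℂ] E} {n : ℕ}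
    (h : nullSpace T ⊓ rangeSpace (T ^ n) = ⊥)
    (hcl : IsClosed (rangeSpace (T ^ (n + 1)) : Set E)) :
    ∃ c > 0, ∀ v ∈ rangeSpace (T ^ n), c * ‖v‖ ≤ ‖T v‖ := by
  have : CompleteSpace (rangeSpace (T ^ (n + 1))) := hcl.completeSpace_coe
  let f : E →L[ℂ] rangeSpace (T ^ (n + 1)) :=
    (T ^ (n + 1)).codRestrict _ fun x => ⟨x, rfl⟩
  obtain ⟨C, hC, hf⟩ := f.exists_preimage_norm_le (by
    rintro ⟨_, x, rfl⟩; exact ⟨x, rfl⟩)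
  refine ⟨(‖T ^ n‖ * C + 1)⁻¹, by positivity, ?_⟩
  rintro _ ⟨x, rfl⟩
  obtain ⟨x', hx', hn⟩ := hf (f x)
  have e1 : (T ^ (n + 1)) x' = (T ^ (n + 1)) x := congrArg Subtype.val hx'
  have e2 : x' - x ∈ nullSpace (T ^ n) := by
    rw [nullSpace_pow_eq_iff.2 h, mem_nullSpace, map_sub, e1, sub_self]
  have e3 : (T ^ n) x' = (T ^ n) x := by
    rw [← sub_eq_zero, ← map_sub]; exact e2
  have e4 : ‖x'‖ ≤ C * ‖T ((T ^ n) x)‖ := by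
    rw [← pow_succ_apply']; exact hn
  have e5 := (T ^ n).le_opNorm x'
  rw [inv_mul_le_iff₀ (by positivity)]
  change ‖(T ^ n) x‖ ≤ _ * ‖T ((T ^ n) x)‖
  rw [← e3] at *
  have e6 := mul_le_mul_of_nonneg_left e4 (norm_nonneg (T ^ n))
  nlinarith [norm_nonneg (T ((T ^ n) x'))]

/-- Closedness of the range descends from `Tⁿ⁺¹` to `Tⁿ` when `n` is at least the ascent of `T`. -/
theorem isClosed_rangeSpace_pow_of_succ {T : E →L[ℂ] E} {n : ℕ}
    (h : nullSpace T ⊓ rangeSpace (T ^ n) = ⊥)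
    (hcl : IsClosed (rangeSpace (T ^ (n + 1)) : Set E)) :
    IsClosed (rangeSpace (T ^ n) : Set E) := by
  obtain ⟨c, hc, hb⟩ := exists_bound_on_rangeSpace_pow h hcl
  refine isClosed_of_closure_subset fun y hy => ?_
  obtain ⟨v, hv, hvy⟩ := mem_closure_iff_seq_limit.1 hy
  have hTy : T y ∈ rangeSpace (T ^ (n + 1)) := by
    refine hcl.mem_of_tendsto ((T.continuous.tendsto y).comp hvy) (Filter.Eventually.of_forall ?_)
    intro k
    obtain ⟨x, hx⟩ := hv k
    exact ⟨x, (pow_succ_apply' T n x).trans (congrArg T hx)⟩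
  obtain ⟨x, hx⟩ := hTy
  have hx : T ((T ^ n) x) = T y := by rw [← pow_succ_apply']; exact hx
  have hlim : Filter.Tendsto v Filter.atTop (nhds ((T ^ n) x)) := by
    rw [tendsto_iff_norm_sub_tendsto_zero]
    have h1 : Filter.Tendsto (fun k => c⁻¹ * ‖T (v k) - T y‖) Filter.atTop (nhds 0) := by
      have := tendsto_iff_norm_sub_tendsto_zero.1 ((T.continuous.tendsto y).comp hvy)
      simpa using this.const_mul c⁻¹
    refine squeeze_zero (fun _ => norm_nonneg _) (fun k => ?_) h1
    have h2 := hb (v k - (T ^ n) x) (sub_mem (hv k) ⟨x, rfl⟩)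
    rw [map_sub, hx] at h2
    rwa [← div_eq_inv_mul, le_div_iff₀ hc, mul_comm]
  rw [tendsto_nhds_unique hvy hlim]
  exact ⟨x, rfl⟩

theorem isLeftDrazinAt_of_le {T : E →L[ℂ] E} {a n : ℕ} (han : a ≤ n)
    (h : nullSpace T ⊓ rangeSpace (T ^ a) = ⊥)
    (hcl : IsClosed (rangeSpace (T ^ (n + 1)) : Set E)) : IsLeftDrazinAt T a := by
  induction n, han using Nat.le_induction with
  | base => exact ⟨isClosed_rangeSpace_pow_of_succ h hcl, hcl, h⟩
  | succ n hn ih =>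
    exact ih (isClosed_rangeSpace_pow_of_succ
      (nullSpace_inf_rangeSpace_mono (hn.trans n.le_succ) h) hcl)

theorem exists_ascent_eq_iff {T : E →L[ℂ] E} :
    (∃ a : ℕ, ascent T = a ∧ IsClosed (rangeSpace (T ^ (a + 1)) : Set E)) ↔
      ∃ n, IsLeftDrazinAt T n := by
  constructor
  · rintro ⟨a, ha, hcl⟩
    exact ⟨a, isLeftDrazinAt_of_le le_rfl (ascent_eq_coe_iff.1 ha).1 hcl⟩
  · rintro ⟨n, -, h, h'⟩
    classical
    have hex : ∃ n, nullSpace T ⊓ rangeSpace (T ^ n) = ⊥ := ⟨n, h'⟩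
    refine ⟨Nat.find hex, ascent_eq_coe_iff.2 ⟨Nat.find_spec hex, fun m => Nat.find_min' hex⟩, ?_⟩
    exact (isLeftDrazinAt_of_le (Nat.find_min' hex h') (Nat.find_spec hex) h).2.1

/-- A left Drazin invertible operator has only bounded below small nonzero shifts. -/
theorem IsLeftDrazinAt.eventually_isBoundedBelow {T : E →L[ℂ] E} {n : ℕ}
    (hT : IsLeftDrazinAt T n) :
    ∃ ε > 0, ∀ w : ℂ, w ≠ 0 → ‖w‖ < ε → IsBoundedBelow (shift T w) := by
  obtain ⟨c, hc, hb⟩ := exists_bound_on_rangeSpace_pow hT.2.2 hT.2.1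
  refine ⟨c, hc, fun w hw0 hw => isBoundedBelow_iff.2 ?_⟩
  obtain ⟨Q, -, hQ⟩ := exists_mul_shift T w n
  have hd : 0 < c - ‖w‖ := by linarith
  have hwn : 0 < ‖w‖ ^ n := by positivity
  refine ⟨‖w‖ ^ n / (‖T ^ n‖ / (c - ‖w‖) + ‖Q‖ + 1), by positivity, fun x => ?_⟩
  have h1 : (T ^ n) x - w ^ n • x = Q (shift T w x) := congrArg (fun S : E →L[ℂ] E => S x) hQ
  have h2 : ‖w‖ ^ n * ‖x‖ ≤ ‖(T ^ n) x‖ + ‖Q (shift T w x)‖ := by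
    rw [← norm_pow, ← norm_smul, ← h1]
    simpa using norm_sub_le ((T ^ n) x) ((T ^ n) x - w ^ n • x)
  have h3 : shift T w ((T ^ n) x) = (T ^ n) (shift T w x) := by
    rw [shift_apply, shift_apply, map_sub, map_smul, ← pow_succ_apply, ← pow_succ_apply']
  have h4 : (c - ‖w‖) * ‖(T ^ n) x‖ ≤ ‖T ^ n‖ * ‖shift T w x‖ := by
    have e1 := hb ((T ^ n) x) ⟨x, rfl⟩
    have e2 := norm_apply_le_norm_shift T w ((T ^ n) x)
    have e3 := (T ^ n).le_opNorm (shift T w x)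
    rw [h3] at e2
    linarith
  have h5 : ‖(T ^ n) x‖ ≤ ‖T ^ n‖ / (c - ‖w‖) * ‖shift T w x‖ := by
    rw [div_mul_eq_mul_div, le_div_iff₀ hd, mul_comm]; exact h4
  have h6 := Q.le_opNorm (shift T w x)
  rw [div_mul_eq_mul_div, div_le_iff₀ (by positivity)]
  nlinarith [norm_nonneg (shift T w x)]

/-- The left poles are the points of the approximate point spectrum at which the operator is left
Drazin invertible; such points are automatically isolated. -/
theorem mem_leftPoles_iff {T : E →L[ℂ] E} {z : ℂ} :
    z ∈ leftPoles T ↔ z ∈ approxPointSpectrum T ∧ ∃ n, IsLeftDrazinAt (shift T z) n := by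
  rw [leftPoles, Set.mem_sep_iff, exists_ascent_eq_iff]
  refine ⟨fun h => ⟨h.1.1, h.2⟩, fun ⟨hz, n, hn⟩ => ⟨⟨hz, ?_⟩, n, hn⟩⟩
  obtain ⟨ε, hε, h⟩ := hn.eventually_isBoundedBelow
  refine ⟨ε, hε, fun w hw hd => ?_⟩
  by_contra hne
  refine hw ?_
  have := h (w - z) (sub_ne_zero.2 hne) (by rwa [← dist_eq_norm])
  rwa [shift_shift, add_sub_cancel] at this

end LeftDrazin

/-! ### Upper semi B-Fredholm operators -/

section Induced

variable {E : Type*} [NormedAddCommGroup E] [NormedSpace ℂ E]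

@[simp] theorem coe_inducedOnRange (S : E →L[ℂ] E) (n : ℕ) (x : rangeSpace (S ^ n)) :
    (inducedOnRange S n x : E) = S x := rfl

theorem coe_inducedOnRange_pow (S : E →L[ℂ] E) (n k : ℕ) (x : rangeSpace (S ^ n)) :
    ((inducedOnRange S n ^ k) x : E) = (S ^ k) x := by
  induction k with
  | zero => simp
  | succ k ih => rw [pow_succ_apply', pow_succ_apply', coe_inducedOnRange, ih]

theorem coe_mem_rangeSpace_inducedOnRange_pow (S : E →L[ℂ] E) (n k : ℕ)
    (x : rangeSpace (S ^ n)) :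
    x ∈ rangeSpace (inducedOnRange S n ^ k) ↔ (x : E) ∈ rangeSpace (S ^ (n + k)) := by
  constructor
  · rintro ⟨⟨_, y, rfl⟩, rfl⟩
    refine ⟨y, ?_⟩
    rw [add_comm, pow_add]
    exact (coe_inducedOnRange_pow S n k ⟨(S ^ n) y, y, rfl⟩).symm
  · rintro ⟨y, hy⟩
    refine ⟨⟨(S ^ n) y, y, rfl⟩, Subtype.ext ?_⟩
    rw [← hy, add_comm, pow_add]
    exact coe_inducedOnRange_pow S n k _

theorem isClosed_rangeSpace_pow_add {S : E →L[ℂ] E} {n k : ℕ}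
    (hcl : IsClosed (rangeSpace (S ^ n) : Set E))
    (h : IsClosed (rangeSpace (inducedOnRange S n ^ k) : Set (rangeSpace (S ^ n)))) :
    IsClosed (rangeSpace (S ^ (n + k)) : Set E) := by
  have := hcl.isClosedEmbedding_subtypeVal.isClosedMap _ h
  convert this using 1
  ext x
  simp only [Set.mem_image, SetLike.mem_coe]
  constructor
  · intro hx
    exact ⟨⟨x, rangeSpace_pow_antitone S (Nat.le_add_right n k) hx⟩,
      (coe_mem_rangeSpace_inducedOnRange_pow S n k _).2 hx, rfl⟩
  · rintro ⟨x, hx, rfl⟩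
    exact (coe_mem_rangeSpace_inducedOnRange_pow S n k x).1 hx

theorem nullSpace_inducedOnRange_inf_eq_bot {S : E →L[ℂ] E} {n k : ℕ} :
    nullSpace (inducedOnRange S n) ⊓ rangeSpace (inducedOnRange S n ^ k) = ⊥ ↔
      nullSpace S ⊓ rangeSpace (S ^ (n + k)) = ⊥ := by
  simp only [eq_bot_iff]
  constructor
  · rintro h x ⟨hx, hx'⟩
    have h1 := h (x := ⟨x, rangeSpace_pow_antitone S (Nat.le_add_right n k) hx'⟩)
      ⟨Subtype.ext hx, (coe_mem_rangeSpace_inducedOnRange_pow S n k _).2 hx'⟩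
    exact congrArg Subtype.val h1
  · rintro h x ⟨hx, hx'⟩
    have h1 := h (x := (x : E))
      ⟨congrArg Subtype.val hx, (coe_mem_rangeSpace_inducedOnRange_pow S n k x).1 hx'⟩
    exact Subtype.ext h1

theorem nullity_le_of_injective {F : Type*} [NormedAddCommGroup F] [NormedSpace ℂ F]
    {T : E →L[ℂ] E} {U : F →L[ℂ] F} (f : nullSpace T →ₗ[ℂ] nullSpace U)
    (hf : Function.Injective f) : nullity T ≤ nullity U := by
  have := OrderHomClass.mono Cardinal.toENat (LinearMap.lift_rank_le_of_injective f hf)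
  simp only [Cardinal.toENat_lift] at this
  exact this

theorem defect_le_of_injective {F : Type*} [NormedAddCommGroup F] [NormedSpace ℂ F]
    {T : E →L[ℂ] E} {U : F →L[ℂ] F} (f : (E ⧸ rangeSpace T) →ₗ[ℂ] (F ⧸ rangeSpace U))
    (hf : Function.Injective f) : defect T ≤ defect U := by
  have := OrderHomClass.mono Cardinal.toENat (LinearMap.lift_rank_le_of_injective f hf)
  simp only [Cardinal.toENat_lift] at this
  exact this

/-- A linear map that intertwines ranges, in the strong sense that preimages of range vectors are
range vectors, does not decrease the defect. -/
theorem defect_le_of_mem_rangeSpace_iff {F : Type*} [NormedAddCommGroup F] [NormedSpace ℂ F]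
    {T : E →L[ℂ] E} {U : F →L[ℂ] F} (f : E →ₗ[ℂ] F)
    (hf : ∀ x, f x ∈ rangeSpace U ↔ x ∈ rangeSpace T) : defect T ≤ defect U := by
  refine defect_le_of_injective
    ((rangeSpace T).mapQ (rangeSpace U) f fun x hx => (hf x).2 hx) ?_
  rw [injective_iff_map_eq_zero]
  intro q
  induction q using Submodule.Quotient.induction_on with
  | H x =>
    intro hx
    exact (Submodule.Quotient.mk_eq_zero _).2
      ((hf x).1 ((Submodule.Quotient.mk_eq_zero (rangeSpace U)).1 hx))

/-- For `w ≠ 0`, the operators `S - w` and `S_n - w` have the same null space, isomorphic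
cokernels, and `R(S - w)` is the preimage of `R(S_n - w)` under `Sⁿ`. -/
theorem IsUpperSemiFredholm.of_shift_inducedOnRange {S : E →L[ℂ] E} {n : ℕ} {w : ℂ} (hw : w ≠ 0)
    (h : IsUpperSemiFredholm (shift (inducedOnRange S n) w))
    (hd : nullity (shift (inducedOnRange S n) w) ≤ defect (shift (inducedOnRange S n) w)) :
    IsUpperSemiFredholm (shift S w) ∧ nullity (shift S w) ≤ defect (shift S w) := by
  set U := inducedOnRange S n with hU
  have hwn : w ^ n ≠ 0 := pow_ne_zero n hw
  obtain ⟨Q, hQS, hQ⟩ := exists_mul_shift S w n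
  have hQ' : ∀ x, w ^ n • x = (S ^ n) x - Q (shift S w x) := fun x => by
    have h1 : (S ^ n) x - w ^ n • x = Q (shift S w x) := congrArg (fun S : E →L[ℂ] E => S x) hQ
    rw [← h1]; abel
  have hQn : ∀ x, Q ((S ^ n) x) = (S ^ n) (Q x) := fun x =>
    congrArg (fun S : E →L[ℂ] E => S x) (hQS.pow_right n).eq
  have hdiv : ∀ (p : Submodule ℂ E) x, w ^ n • x ∈ p → x ∈ p := fun p x hx =>
    (p.smul_mem_iff hwn).1 hx
  have hcoe : ∀ x : rangeSpace (S ^ n), (shift U w x : E) = shift S w x := fun x => rfl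
  have hker : ∀ x, shift S w x = 0 → x ∈ rangeSpace (S ^ n) := fun x hx => by
    refine hdiv _ x ?_
    rw [hQ', hx, map_zero, sub_zero]
    exact ⟨x, rfl⟩
  have hran : ∀ x : rangeSpace (S ^ n), x ∈ rangeSpace (shift U w) ↔
      (x : E) ∈ rangeSpace (shift S w) := by
    rintro ⟨_, v, rfl⟩
    constructor
    · rintro ⟨y, hy⟩
      exact ⟨y, (hcoe y).symm.trans (congrArg Subtype.val hy)⟩
    · rintro ⟨y, hy⟩
      have hy : shift S w y = (S ^ n) v := hy
      have hyn : y ∈ rangeSpace (S ^ n) := hdiv _ y (by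
        rw [hQ', hy, hQn, ← map_sub]; exact ⟨_, rfl⟩)
      exact ⟨⟨y, hyn⟩, Subtype.ext hy⟩
  let p : E →L[ℂ] rangeSpace (S ^ n) := (S ^ n).codRestrict _ fun x => ⟨x, rfl⟩
  have hcomm : ∀ x, (S ^ n) (shift S w x) = shift S w ((S ^ n) x) := fun x => by
    rw [shift_apply, shift_apply, map_sub, map_smul, ← pow_succ_apply, ← pow_succ_apply']
  have hpre : ∀ x, x ∈ rangeSpace (shift S w) ↔ p x ∈ rangeSpace (shift U w) := by
    intro x
    rw [hran]
    constructor
    · rintro ⟨y, rfl⟩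
      exact ⟨(S ^ n) y, (hcomm y).symm⟩
    · intro hx
      refine hdiv _ x ?_
      have h1 : shift S w (Q x) = Q (shift S w x) := by
        rw [shift_apply, shift_apply, map_sub, map_smul]
        congr 1
        exact congrArg (fun S : E →L[ℂ] E => S x) hQS.eq.symm
      rw [hQ', ← h1]
      exact sub_mem hx ⟨_, rfl⟩
  have hnull : nullity (shift S w) ≤ nullity (shift U w) := by
    let f : nullSpace (shift S w) →ₗ[ℂ] nullSpace (shift U w) :=
      LinearMap.codRestrict _ ((nullSpace (shift S w)).subtype.codRestrict (rangeSpace (S ^ n))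
        fun x => hker x x.2) fun x => Subtype.ext x.2
    exact nullity_le_of_injective f fun x y hxy => Subtype.ext
      (congrArg (fun v : nullSpace (shift U w) => ((v : rangeSpace (S ^ n)) : E)) hxy)
  refine ⟨⟨?_, hnull.trans_lt h.2⟩, hnull.trans (hd.trans ?_)⟩
  · have : (rangeSpace (shift S w) : Set E) = p ⁻¹' rangeSpace (shift U w) :=
      Set.ext hpre
    rw [this]
    exact h.1.preimage p.continuous
  · exact defect_le_of_mem_rangeSpace_iff (rangeSpace (S ^ n)).subtype fun x => (hran x).symm

/-- Upper semi-Fredholm operators of nonpositive index are upper semi B-Fredholm at `0`, where the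
induced operator is a copy of `S` on the subspace `⊤`. -/
theorem isUpperSemiBFredholmAt_zero {S : E →L[ℂ] E} (h : IsUpperSemiFredholm S)
    (hd : nullity S ≤ defect S) :
    IsUpperSemiBFredholmAt S 0 ∧ index (inducedOnRange S 0) ≤ 0 := by
  have htop : rangeSpace (S ^ 0) = ⊤ := LinearMap.range_eq_top.2 fun x => ⟨x, by simp⟩
  have hmem : ∀ x, x ∈ rangeSpace (S ^ 0) := fun x => htop ▸ Submodule.mem_top
  have hran : ∀ x : rangeSpace (S ^ 0), x ∈ rangeSpace (inducedOnRange S 0) ↔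
      (x : E) ∈ rangeSpace S := fun x => by
    simpa using coe_mem_rangeSpace_inducedOnRange_pow S 0 1 x
  have hnull : nullity (inducedOnRange S 0) ≤ nullity S := by
    let f : nullSpace (inducedOnRange S 0) →ₗ[ℂ] nullSpace S :=
      ((rangeSpace (S ^ 0)).subtype ∘ₗ (nullSpace (inducedOnRange S 0)).subtype).codRestrict _
        fun x => congrArg Subtype.val x.2
    exact nullity_le_of_injective f fun x y hxy =>
      Subtype.ext (Subtype.ext (congrArg (fun v : nullSpace S => (v : E)) hxy))
  have hSF : IsUpperSemiFredholm (inducedOnRange S 0) := by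
    refine ⟨?_, hnull.trans_lt h.2⟩
    have : (rangeSpace (inducedOnRange S 0) : Set (rangeSpace (S ^ 0))) =
        Subtype.val ⁻¹' (rangeSpace S : Set E) := Set.ext hran
    rw [this]
    exact h.1.preimage continuous_subtype_val
  refine ⟨⟨by rw [htop]; exact isClosed_univ, hSF⟩, (index_nonpos_iff hSF.2).2 ?_⟩
  refine hnull.trans (hd.trans ?_)
  exact defect_le_of_mem_rangeSpace_iff
    (LinearMap.id.codRestrict (rangeSpace (S ^ 0)) hmem) fun x => hran _

variable [CompleteSpace E]

theorem IsLeftDrazinAt.isUpperSemiBFredholmAt {S : E →L[ℂ] E} {n : ℕ} (h : IsLeftDrazinAt S n) :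
    IsUpperSemiBFredholmAt S n ∧ index (inducedOnRange S n) ≤ 0 := by
  have : CompleteSpace (rangeSpace (S ^ n)) := h.1.completeSpace_coe
  obtain ⟨c, hc, hb⟩ := exists_bound_on_rangeSpace_pow h.2.2 h.2.1
  have hbb : IsBoundedBelow (inducedOnRange S n) :=
    isBoundedBelow_iff.2 ⟨c, hc, fun x => hb x x.2⟩
  exact ⟨⟨h.1, hbb.isUpperSemiFredholm⟩, hbb.index_nonpos⟩

theorem IsUpperSemiBFredholmAt.exists_isLeftDrazinAt {S : E →L[ℂ] E} {n m : ℕ}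
    (h : IsUpperSemiBFredholmAt S n) (hm : nullSpace S ⊓ rangeSpace (S ^ m) = ⊥) :
    ∃ k, IsLeftDrazinAt S k := by
  have : CompleteSpace (rangeSpace (S ^ n)) := h.1.completeSpace_coe
  have h1 := isClosed_rangeSpace_pow_add h.1 (h.2.pow (m + 1)).1
  exact ⟨m, isLeftDrazinAt_of_le (Nat.le_add_left m n) hm h1⟩

/-- An upper semi B-Fredholm operator that is not left Drazin invertible has only eigenvalues
near `0`. -/
theorem IsUpperSemiBFredholmAt.eventually_nullSpace_ne_bot {S : E →L[ℂ] E} {n : ℕ}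
    (h : IsUpperSemiBFredholmAt S n) (hS : ∀ k, ¬ IsLeftDrazinAt S k) :
    ∃ ε > 0, ∀ w : ℂ, ‖w‖ < ε → nullSpace (shift S w) ≠ ⊥ := by
  have : CompleteSpace (rangeSpace (S ^ n)) := h.1.completeSpace_coe
  obtain ⟨ε, hε, H⟩ := h.2.eventually_nullSpace_ne_bot fun k hk => by
    obtain ⟨l, hl⟩ := h.exists_isLeftDrazinAt (nullSpace_inducedOnRange_inf_eq_bot.1 hk)
    exact hS l hl
  refine ⟨ε, hε, fun w hw hbot => H w hw ?_⟩
  rw [eq_bot_iff] at hbot ⊢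
  intro x hx
  have h1 := hbot (x := (x : E)) (congrArg Subtype.val hx)
  exact Subtype.ext h1

/-- The small nonzero shifts of an upper semi B-Fredholm operator of nonpositive index are upper
semi-Fredholm of nonpositive index. -/
theorem IsUpperSemiBFredholmAt.eventually_shift {S : E →L[ℂ] E} {n : ℕ}
    (h : IsUpperSemiBFredholmAt S n) (hi : index (inducedOnRange S n) ≤ 0) :
    ∃ ε > 0, ∀ w : ℂ, w ≠ 0 → ‖w‖ < ε →
      IsUpperSemiFredholm (shift S w) ∧ nullity (shift S w) ≤ defect (shift S w) := by
  have : CompleteSpace (rangeSpace (S ^ n)) := h.1.completeSpace_coe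
  obtain ⟨ε, hε, H⟩ := h.2.eventually_shift ((index_nonpos_iff h.2.2).1 hi)
  exact ⟨ε, hε, fun w hw0 hw => IsUpperSemiFredholm.of_shift_inducedOnRange hw0 (H w hw).1 (H w hw).2⟩

theorem finiteDimensional_nullSpace_pow {E : Type*} [NormedAddCommGroup E] [NormedSpace ℂ E]
    {S : E →L[ℂ] E} (h : FiniteDimensional ℂ (nullSpace S)) (k : ℕ) :
    FiniteDimensional ℂ (nullSpace (S ^ k)) := by
  induction k with
  | zero =>
    have : nullSpace (S ^ 0) = ⊥ := nullSpace_eq_bot.2 fun x y hxy => by simpa using hxy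
    rw [this]; infer_instance
  | succ k ih =>
    let f : nullSpace (S ^ (k + 1)) →ₗ[ℂ] nullSpace (S ^ k) :=
      ((S : E →ₗ[ℂ] E) ∘ₗ (nullSpace (S ^ (k + 1))).subtype).codRestrict _ fun x => by
        have := x.2
        rw [mem_nullSpace, pow_succ_apply] at this
        exact this
    let g : LinearMap.ker f →ₗ[ℂ] nullSpace S :=
      ((nullSpace (S ^ (k + 1))).subtype ∘ₗ (LinearMap.ker f).subtype).codRestrict _ fun x =>
        congrArg Subtype.val x.2
    have : FiniteDimensional ℂ (LinearMap.ker f) := FiniteDimensional.of_injective g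
      fun x y hxy => Subtype.ext (Subtype.ext (congrArg (fun v : nullSpace S => (v : E)) hxy))
    have : FiniteDimensional ℂ (nullSpace (S ^ (k + 1)) ⧸ LinearMap.ker f) :=
      Module.Finite.equiv (LinearMap.quotKerEquivRange f).symm
    exact Module.Finite.of_submodule_quotient (LinearMap.ker f)

/-- A left Drazin invertible operator of finite nullity is upper semi-Fredholm of nonpositive
index. -/
theorem IsLeftDrazinAt.isUpperSemiFredholm {S : E →L[ℂ] E} {n : ℕ} (h : IsLeftDrazinAt S n)
    (hS : nullity S < ⊤) : IsUpperSemiFredholm S ∧ nullity S ≤ defect S := by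
  have hf := nullity_lt_top.1 hS
  have h1 : IsUpperSemiFredholm (S ^ (n + 1)) :=
    isUpperSemiFredholm_def.2 ⟨h.2.1, finiteDimensional_nullSpace_pow hf _⟩
  refine ⟨h1.of_pow, nullity_le_defect_of_finrank hS fun hc => ?_⟩
  have e : ∀ k, LinearMap.ker ((S : E →ₗ[ℂ] E) ^ k) = nullSpace (S ^ k) := fun k => by
    rw [nullSpace, ContinuousLinearMap.toLinearMap_pow]
  have : FiniteDimensional ℂ (LinearMap.ker ((S : E →ₗ[ℂ] E) ^ n)) := by
    rw [e]; exact finiteDimensional_nullSpace_pow hf n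
  have : FiniteDimensional ℂ (E ⧸ LinearMap.range (S : E →ₗ[ℂ] E)) := hc
  exact finrank_ker_le_of_ker_pow_eq (S : E →ₗ[ℂ] E) n (by
    rw [e, e]; exact nullSpace_pow_eq_iff.2 h.2.2)

end Induced

/-! ### Browder's theorem and the B-Weyl spectrum -/

section ABrowder

variable {E : Type*} [NormedAddCommGroup E] [NormedSpace ℂ E]

theorem notMem_upperSemiBWeylSpectrum {T : E →L[ℂ] E} {z : ℂ} :
    z ∉ upperSemiBWeylSpectrum T ↔ ∃ n, IsUpperSemiBFredholmAt (shift T z) n ∧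
      index (inducedOnRange (shift T z) n) ≤ 0 := not_not

theorem notMem_weylApproxSpectrum {T : E →L[ℂ] E} {z : ℂ} (hz : z ∈ approxPointSpectrum T) :
    z ∉ weylApproxSpectrum T ↔ IsUpperSemiFredholm (shift T z) ∧
      nullity (shift T z) ≤ defect (shift T z) := by
  have : z ∉ weylApproxSpectrum T ↔ IsUpperSemiFredholm (shift T z) ∧ index (shift T z) ≤ 0 := by
    rw [weylApproxSpectrum, Set.mem_sep_iff, not_and, not_or, not_not, not_lt]
    exact ⟨fun h => h hz, fun h _ => h⟩
  rw [this]
  exact and_congr_right fun h => index_nonpos_iff h.2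

variable [CompleteSpace E]

theorem upperSemiBWeylSpectrum_subset (T : E →L[ℂ] E) :
    upperSemiBWeylSpectrum T ⊆ approxPointSpectrum T \ leftPoles T := by
  intro z hz
  have h : ∀ n, ¬ IsLeftDrazinAt (shift T z) n := fun n hn =>
    notMem_upperSemiBWeylSpectrum.2 ⟨n, hn.isUpperSemiBFredholmAt⟩ hz
  exact ⟨fun hb => h 0 (isLeftDrazinAt_zero.2 hb),
    fun hp => (mem_leftPoles_iff.1 hp).2.elim h⟩

/-- `a`-Browder's theorem and its generalised, B-Fredholm, version are equivalent. -/
theorem satisfiesABrowder_iff {T : E →L[ℂ] E} :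
    SatisfiesABrowder T ↔
      upperSemiBWeylSpectrum T = approxPointSpectrum T \ leftPoles T := by
  constructor
  · intro hT
    refine (upperSemiBWeylSpectrum_subset T).antisymm fun z hz => ?_
    by_contra hzB
    obtain ⟨n, hn, hi⟩ := notMem_upperSemiBWeylSpectrum.1 hzB
    have hLD : ∀ k, ¬ IsLeftDrazinAt (shift T z) k := fun k hk =>
      hz.2 (mem_leftPoles_iff.2 ⟨hz.1, k, hk⟩)
    obtain ⟨ε₁, hε₁, H₁⟩ := hn.eventually_nullSpace_ne_bot hLD
    obtain ⟨ε₂, hε₂, H₂⟩ := hn.eventually_shift hi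
    obtain ⟨w, hw0, hw⟩ := NormedField.exists_norm_lt ℂ (lt_min hε₁ hε₂)
    have hw0 : w ≠ 0 := norm_pos_iff.1 hw0
    have hSF := H₂ w hw0 (hw.trans_le (min_le_right _ _))
    rw [shift_shift] at hSF
    have hza : z + w ∈ approxPointSpectrum T := fun hb =>
      H₁ w (hw.trans_le (min_le_left _ _)) (by rw [shift_shift]; exact hb.1)
    have hpole : z + w ∈ finiteRankLeftPoles T := by
      by_contra hne
      have h1 : z + w ∈ weylApproxSpectrum T := by
        rw [hT]; exact ⟨hza, hne⟩
      exact (notMem_weylApproxSpectrum hza).2 hSF h1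
    -- A left pole is isolated in `σ_a(T)`, whereas all points near `z` are eigenvalues.
    obtain ⟨k, hk⟩ := (mem_leftPoles_iff.1 hpole.1).2
    obtain ⟨δ, hδ, H⟩ := hk.eventually_isBoundedBelow
    have hgap : 0 < ε₁ - ‖w‖ := sub_pos.2 (hw.trans_le (min_le_left _ _))
    obtain ⟨v, hv0, hv⟩ := NormedField.exists_norm_lt ℂ (lt_min hδ hgap)
    have hb := H v (norm_pos_iff.1 hv0) (hv.trans_le (min_le_left _ _))
    refine H₁ (w + v) ?_ ?_
    · have := norm_add_le w v
      have := hv.trans_le (min_le_right _ _)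
      linarith
    · rw [shift_shift, add_assoc] at hb
      rw [shift_shift]; exact hb.1
  · intro hT
    ext z
    constructor
    · refine fun hz => ⟨hz.1, fun hp => ?_⟩
      obtain ⟨n, hn⟩ := (mem_leftPoles_iff.1 hp.1).2
      exact (notMem_weylApproxSpectrum hz.1).2 (hn.isUpperSemiFredholm hp.2) hz
    · rintro ⟨hz, hp⟩
      by_contra hw
      obtain ⟨h1, h2⟩ := (notMem_weylApproxSpectrum hz).1 hw
      have h3 : z ∉ upperSemiBWeylSpectrum T :=
        notMem_upperSemiBWeylSpectrum.2 ⟨0, isUpperSemiBFredholmAt_zero h1 h2⟩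
      rw [hT] at h3
      have h4 : z ∈ leftPoles T := by
        by_contra h4; exact h3 ⟨hz, h4⟩
      exact hp ⟨h4, h1.2⟩

/-- Under `a`-Browder's theorem, `σ_{SBF₊⁻}(T)` is the left Drazin spectrum of `T`. -/
theorem SatisfiesABrowder.mem_upperSemiBWeylSpectrum_iff {T : E →L[ℂ] E}
    (hT : SatisfiesABrowder T) {z : ℂ} :
    z ∈ upperSemiBWeylSpectrum T ↔ ¬ ∃ n, IsLeftDrazinAt (shift T z) n := by
  rw [satisfiesABrowder_iff.1 hT, Set.mem_sdiff, mem_leftPoles_iff]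
  constructor
  · rintro ⟨h1, h2⟩ h3; exact h2 ⟨h1, h3⟩
  · exact fun h => ⟨fun hb => h ⟨0, isLeftDrazinAt_zero.2 hb⟩, fun h' => h h'.2⟩

/-- Comparison with an operator `U` that satisfies `a`-Browder's theorem and has the same
approximate point spectrum. If the B-Weyl spectra agree, then the left poles of `U` are isolated
points of `σ_a(T)` at which `T` is upper semi B-Fredholm, and so they are left poles of `T`. -/
theorem satisfiesABrowder_and_leftPoles_eq_iff {F : Type*} [NormedAddCommGroup F]
    [NormedSpace ℂ F] [CompleteSpace F] {T : E →L[ℂ] E} {U : F →L[ℂ] F}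
    (hU : SatisfiesABrowder U) (ha : approxPointSpectrum U = approxPointSpectrum T) :
    SatisfiesABrowder T ∧ leftPoles T = leftPoles U ↔
      upperSemiBWeylSpectrum T = upperSemiBWeylSpectrum U := by
  rw [satisfiesABrowder_iff] at hU ⊢
  rw [hU, ha]
  constructor
  · rintro ⟨h1, h2⟩; rw [h1, h2]
  · intro h
    have hP : leftPoles T = leftPoles U := by
      ext z
      constructor
      · intro hz
        by_contra hne
        have h1 : z ∈ upperSemiBWeylSpectrum T := by rw [h]; exact ⟨hz.1.1, hne⟩
        exact (upperSemiBWeylSpectrum_subset T h1).2 hz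
      · intro hz
        have hza : z ∈ isolatedPoints (approxPointSpectrum T) := ha ▸ hz.1
        have h1 : z ∉ upperSemiBWeylSpectrum T := by rw [h]; exact fun h' => h'.2 hz
        obtain ⟨n, hn, -⟩ := notMem_upperSemiBWeylSpectrum.1 h1
        by_contra hne
        obtain ⟨ε, hε, H⟩ := hn.eventually_nullSpace_ne_bot fun k hk =>
          hne (mem_leftPoles_iff.2 ⟨hza.1, k, hk⟩)
        obtain ⟨-, δ, hδ, hiso⟩ := hza
        obtain ⟨w, hw0, hw⟩ := NormedField.exists_norm_lt ℂ (lt_min hε hδ)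
        have h2 := hiso (z + w)
          (fun hb => H w (hw.trans_le (min_le_left _ _)) (by rw [shift_shift]; exact hb.1))
          (by simpa [dist_eq_norm] using hw.trans_le (min_le_right _ _))
        exact norm_pos_iff.1 hw0 (by simpa using h2)
    exact ⟨by rw [h, hP], hP⟩

end ABrowder

/-! ### Left and right multiplication operators -/

section Multiplication

variable {X : Type*} [NormedAddCommGroup X] [NormedSpace ℂ X]

@[simp] theorem leftMul_apply (A S : X →L[ℂ] X) : leftMul A S = A * S := rfl

@[simp] theorem rightMul_apply (A S : X →L[ℂ] X) : rightMul A S = S * A := rfl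

theorem shift_leftMul (A : X →L[ℂ] X) (z : ℂ) : shift (leftMul A) z = leftMul (shift A z) := by
  ext S x; simp

theorem shift_rightMul (A : X →L[ℂ] X) (z : ℂ) : shift (rightMul A) z = rightMul (shift A z) := by
  ext S x; simp

theorem leftMul_pow (A : X →L[ℂ] X) (n : ℕ) : leftMul A ^ n = leftMul (A ^ n) := by
  induction n with
  | zero => ext S x; simp
  | succ n ih =>
    refine ContinuousLinearMap.ext fun S => ?_
    rw [pow_succ_apply, ih, leftMul_apply, leftMul_apply, leftMul_apply, pow_succ, mul_assoc]

theorem rightMul_pow (A : X →L[ℂ] X) (n : ℕ) : rightMul A ^ n = rightMul (A ^ n) := by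
  induction n with
  | zero => ext S x; simp
  | succ n ih =>
    refine ContinuousLinearMap.ext fun S => ?_
    rw [pow_succ_apply, ih, rightMul_apply, rightMul_apply, rightMul_apply, pow_succ', mul_assoc]

theorem mul_smulRight (A : X →L[ℂ] X) (f : StrongDual ℂ X) (y : X) :
    A * f.smulRight y = f.smulRight (A y) := by
  ext x; simp

theorem smulRight_mul (A : X →L[ℂ] X) (f : StrongDual ℂ X) (y : X) :
    f.smulRight y * A = (f.comp A).smulRight y := by
  ext x; simp

/-- The dual of an infinite-dimensional normed space is infinite-dimensional. -/
theorem not_finiteDimensional_strongDual (hX : ¬ FiniteDimensional ℂ X) :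
    ¬ FiniteDimensional ℂ (StrongDual ℂ X) := fun h => by
  let J : X →ₗ[ℂ] Module.Dual ℂ (StrongDual ℂ X) :=
    { toFun := fun x => ⟨⟨fun f => f x, fun _ _ => rfl⟩, fun _ _ => rfl⟩
      map_add' := fun x y => LinearMap.ext fun f => map_add f x y
      map_smul' := fun c x => LinearMap.ext fun f => map_smul f c x }
  refine hX (FiniteDimensional.of_injective J ((injective_iff_map_eq_zero J).2 fun x hx => ?_))
  by_contra h0
  obtain ⟨f, hf⟩ := SeparatingDual.exists_eq_one (R := ℂ) h0
  have h1 : f x = 0 := LinearMap.congr_fun hx f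
  rw [hf] at h1
  exact one_ne_zero h1

/-- On an infinite-dimensional space, a finite-dimensional null space of `L_B` is trivial: with
`S` it contains all operators `S ∘ (f ⊗ u)`. -/
theorem nullSpace_leftMul_eq_bot (hX : ¬ FiniteDimensional ℂ X) {B : X →L[ℂ] X}
    (hB : FiniteDimensional ℂ (nullSpace (leftMul B))) : nullSpace (leftMul B) = ⊥ := by
  rw [eq_bot_iff]
  intro S hS
  rw [mem_nullSpace, leftMul_apply] at hS
  refine (Submodule.mem_bot ℂ).2 (ContinuousLinearMap.ext fun u => ?_)
  by_contra h0
  have hBu : B (S u) = 0 := congrArg (fun T : X →L[ℂ] X => T u) hS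
  let J : StrongDual ℂ X →ₗ[ℂ] nullSpace (leftMul B) :=
    { toFun := fun f => ⟨f.smulRight (S u), by
        rw [mem_nullSpace, leftMul_apply, mul_smulRight, hBu]; ext; simp⟩
      map_add' := fun f g => Subtype.ext (by ext x; simp [add_smul])
      map_smul' := fun c f => Subtype.ext (by ext x; simp [mul_smul]) }
  refine not_finiteDimensional_strongDual hX
    (FiniteDimensional.of_injective J ((injective_iff_map_eq_zero J).2 fun f hf => ?_))
  ext x
  have h1 : f x • S u = 0 := congrArg (fun T : nullSpace (leftMul B) => (T : X →L[ℂ] X) x) hf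
  exact (smul_eq_zero.1 h1).resolve_right h0

/-- On an infinite-dimensional space, a finite-dimensional null space of `R_B` is trivial: with
`S` it contains all operators `(g ⊗ y) ∘ S`. -/
theorem nullSpace_rightMul_eq_bot (hX : ¬ FiniteDimensional ℂ X) {B : X →L[ℂ] X}
    (hB : FiniteDimensional ℂ (nullSpace (rightMul B))) : nullSpace (rightMul B) = ⊥ := by
  rw [eq_bot_iff]
  intro S hS
  rw [mem_nullSpace, rightMul_apply] at hS
  refine (Submodule.mem_bot ℂ).2 (ContinuousLinearMap.ext fun u => ?_)
  by_contra h0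
  obtain ⟨g, hg⟩ := SeparatingDual.exists_eq_one (R := ℂ) h0
  let J : X →ₗ[ℂ] nullSpace (rightMul B) :=
    { toFun := fun y => ⟨g.smulRight y * S, by
        rw [mem_nullSpace, rightMul_apply, mul_assoc, hS, mul_zero]⟩
      map_add' := fun x y => Subtype.ext (by ext; simp)
      map_smul' := fun c x => Subtype.ext (ContinuousLinearMap.ext fun v => smul_comm (g (S v)) c x) }
  refine hX (FiniteDimensional.of_injective J ((injective_iff_map_eq_zero J).2 fun y hy => ?_))
  have h1 : g (S u) • y = 0 := congrArg (fun T : nullSpace (rightMul B) => (T : X →L[ℂ] X) u) hy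
  rwa [hg, one_smul] at h1

theorem exists_dual_eq_one (hX : ¬ FiniteDimensional ℂ X) :
    ∃ (f : StrongDual ℂ X) (u : X), f u = 1 := by
  have : Nontrivial X := by
    by_contra h
    rw [not_nontrivial_iff_subsingleton] at h
    exact hX inferInstance
  obtain ⟨u, hu⟩ := exists_ne (0 : X)
  obtain ⟨f, hf⟩ := SeparatingDual.exists_eq_one (R := ℂ) hu
  exact ⟨f, u, hf⟩

/-- `R(C)` is the preimage of `R(L_C)` under `y ↦ f ⊗ y`, for any functional `f ≠ 0`. -/
theorem isClosed_rangeSpace_of_leftMul (hX : ¬ FiniteDimensional ℂ X) {C : X →L[ℂ] X}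
    (hC : IsClosed (rangeSpace (leftMul C) : Set (X →L[ℂ] X))) :
    IsClosed (rangeSpace C : Set X) := by
  obtain ⟨f, u, hu⟩ := exists_dual_eq_one hX
  have : (rangeSpace C : Set X) =
      (fun y => f.smulRight y) ⁻¹' (rangeSpace (leftMul C) : Set (X →L[ℂ] X)) := by
    ext y
    constructor
    · rintro ⟨x, rfl⟩
      exact ⟨f.smulRight x, mul_smulRight C f x⟩
    · rintro ⟨S, hS⟩
      have hS : C * S = f.smulRight y := hS
      refine ⟨S u, ?_⟩
      have := congrArg (fun T : X →L[ℂ] X => T u) hS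
      simpa [hu] using this
  rw [this]
  exact hC.preimage (ContinuousLinearMap.smulRightL ℂ X X f).continuous

theorem nullSpace_leftMul_inf_eq_bot_iff (hX : ¬ FiniteDimensional ℂ X) {B : X →L[ℂ] X} {n : ℕ} :
    nullSpace (leftMul B) ⊓ rangeSpace (leftMul B ^ n) = ⊥ ↔
      nullSpace B ⊓ rangeSpace (B ^ n) = ⊥ := by
  simp only [leftMul_pow, eq_bot_iff]
  constructor
  · rintro h _ ⟨hx, y, rfl⟩
    have hx : B ((B ^ n) y) = 0 := hx
    obtain ⟨f, u, hu⟩ := exists_dual_eq_one hX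
    have h1 := h (x := f.smulRight ((B ^ n) y))
      ⟨by
        change B * f.smulRight ((B ^ n) y) = 0
        rw [mul_smulRight, hx]
        ext; simp, f.smulRight y, mul_smulRight _ f y⟩
    have h2 : f u • (B ^ n) y = 0 :=
      congrArg (fun T : X →L[ℂ] X => T u) ((Submodule.mem_bot ℂ).1 h1)
    rw [hu, one_smul] at h2
    exact h2
  · rintro h _ ⟨hx, V, rfl⟩
    refine (Submodule.mem_bot ℂ).2 (ContinuousLinearMap.ext fun u => ?_)
    exact h (x := (B ^ n) (V u)) ⟨congrArg (fun T : X →L[ℂ] X => T u) hx, V u, rfl⟩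

variable [CompleteSpace X]

theorem isBoundedBelow_leftMul_iff (hX : ¬ FiniteDimensional ℂ X) {B : X →L[ℂ] X} :
    IsBoundedBelow (leftMul B) ↔ IsBoundedBelow B := by
  constructor
  · intro h
    rw [← isLeftDrazinAt_zero] at h ⊢
    refine ⟨isClosed_rangeSpace_of_leftMul hX ?_, isClosed_rangeSpace_of_leftMul hX ?_,
      (nullSpace_leftMul_inf_eq_bot_iff hX).1 h.2.2⟩
    · rw [← leftMul_pow]; exact h.1
    · rw [← leftMul_pow]; exact h.2.1
  · intro h
    obtain ⟨c, hc, hb⟩ := isBoundedBelow_iff.1 h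
    refine isBoundedBelow_iff.2 ⟨c, hc, fun S => ?_⟩
    rw [mul_comm, ← le_div_iff₀ hc]
    refine S.opNorm_le_bound (by positivity) fun x => ?_
    rw [div_mul_eq_mul_div, le_div_iff₀ hc, mul_comm]
    exact (hb (S x)).trans ((B * S).le_opNorm x)

/-- If the transpose of `A` is bounded below then `A` is surjective. By Hahn-Banach, the image of
a ball is dense in a ball; successive approximation then solves the equation `A x = y`. -/
theorem surjective_of_transpose_bound {A : X →L[ℂ] X} {c : ℝ} (hc : 0 < c)
    (h : ∀ f : StrongDual ℂ X, c * ‖f‖ ≤ ‖f.comp A‖) : Function.Surjective A := by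
  have happrox : ∀ y : X, ∃ x, ‖y - A x‖ ≤ 1 / 2 * ‖y‖ ∧ ‖x‖ ≤ 2 / c * ‖y‖ := by
    intro y
    rcases eq_or_ne y 0 with rfl | hy
    · exact ⟨0, by simp⟩
    have hy0 : 0 < ‖y‖ := norm_pos_iff.2 hy
    set r := 2 / c * ‖y‖ with hr
    have hr0 : 0 < r := by positivity
    have hcl : y ∈ closure (A '' Metric.ball 0 r) := by
      by_contra hne
      have hconv : Convex ℝ (closure (A '' Metric.ball (0 : X) r)) :=
        ((convex_ball (0 : X) r).linear_image (A.restrictScalars ℝ : X →ₗ[ℝ] X)).closure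
      obtain ⟨f, u, hu, huy⟩ := RCLike.geometric_hahn_banach_closed_point (𝕜 := ℂ) hconv
        isClosed_closure hne
      have hu' : ∀ x, ‖x‖ < r → (f (A x)).re < u := fun x hx =>
        hu _ (subset_closure ⟨x, by simpa using hx, rfl⟩)
      have hu0 : 0 < u := by simpa using hu' 0 (by simpa using hr0)
      have hb : ‖f.comp A‖ ≤ 2 * u / r := by
        refine ContinuousLinearMap.opNorm_le_bound _ (by positivity) fun x => ?_
        change ‖f (A x)‖ ≤ _
        rcases eq_or_ne (f (A x)) 0 with h0 | h0
        · rw [h0, norm_zero]; positivity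
        have hx0 : x ≠ 0 := fun hx => h0 (by rw [hx, map_zero, map_zero])
        have hxn : 0 < ‖x‖ := norm_pos_iff.2 hx0
        have hfn : 0 < ‖f (A x)‖ := norm_pos_iff.2 h0
        -- Rotate and rescale `x` to a vector of norm `r / 2` at which the functional is positive.
        let t : ℂ := (r / (2 * ‖x‖ * ‖f (A x)‖) : ℝ) * (starRingEnd ℂ) (f (A x))
        have ht : ‖t • x‖ = r / 2 := by
          rw [norm_smul, norm_mul, Complex.norm_real, RCLike.norm_conj,
            Real.norm_of_nonneg (by positivity)]
          field_simp
        have hft : f (A (t • x)) = ((r * ‖f (A x)‖ / (2 * ‖x‖) : ℝ) : ℂ) := by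
          have e : (starRingEnd ℂ) (f (A x)) * f (A x) = ((‖f (A x)‖ ^ 2 : ℝ) : ℂ) := by
            rw [mul_comm, Complex.mul_conj, Complex.normSq_eq_norm_sq]
          rw [map_smul, map_smul, smul_eq_mul, mul_assoc, e, ← Complex.ofReal_mul]
          congr 1
          field_simp
        have h1 := hu' (t • x) (by rw [ht]; linarith)
        rw [hft, Complex.ofReal_re, div_lt_iff₀ (by positivity)] at h1
        rw [div_mul_eq_mul_div, le_div_iff₀ hr0]
        linarith
      have h1 := h f
      have h2 : u < ‖f‖ * ‖y‖ :=
        (huy.trans_le (Complex.re_le_norm _)).trans_le (f.le_opNorm y)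
      have h3 : 2 * u / r < c * ‖f‖ := by
        rw [div_lt_iff₀ hr0, hr]
        have : c * ‖f‖ * (2 / c * ‖y‖) = 2 * (‖f‖ * ‖y‖) := by field_simp
        rw [this]; linarith
      linarith
    obtain ⟨_, ⟨x, hx, rfl⟩, hxy⟩ := Metric.mem_closure_iff.1 hcl (1 / 2 * ‖y‖) (by positivity)
    exact ⟨x, by rw [← dist_eq_norm]; exact hxy.le, by simpa using (mem_ball_zero_iff.1 hx).le⟩
  choose g hg hgn using happrox
  intro y
  let e : X → X := fun v => v - A (g v)
  have hn : ∀ n, ‖e^[n] y‖ ≤ (1 / 2) ^ n * ‖y‖ := fun n => by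
    induction n with
    | zero => simp
    | succ n ih =>
      rw [Function.iterate_succ_apply', pow_succ', mul_assoc]
      exact (hg _).trans (by linarith)
  have hs : Summable fun n => g (e^[n] y) := by
    refine Summable.of_norm_bounded (g := fun n : ℕ => 2 / c * ‖y‖ * (1 / 2 : ℝ) ^ n)
      (summable_geometric_two.mul_left _) fun n => ?_
    refine (hgn _).trans ?_
    rw [mul_assoc, mul_comm ‖y‖]
    exact mul_le_mul_of_nonneg_left (hn n) (by positivity)
  refine ⟨∑' n, g (e^[n] y), ?_⟩
  have hA : HasSum (fun n => A (g (e^[n] y))) (A (∑' n, g (e^[n] y))) := A.hasSum hs.hasSum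
  refine tendsto_nhds_unique hA.tendsto_sum_nat ?_
  have hsum : ∀ N, ∑ n ∈ Finset.range N, A (g (e^[n] y)) = y - e^[N] y := fun N => by
    induction N with
    | zero => simp
    | succ N ih =>
      rw [Finset.sum_range_succ, ih, Function.iterate_succ_apply']
      simp only [e]; abel
  simp only [hsum]
  have hlim : Filter.Tendsto (fun N => e^[N] y) Filter.atTop (nhds 0) := by
    refine squeeze_zero_norm hn ?_
    simpa using (tendsto_pow_atTop_nhds_zero_of_lt_one (r := (1 / 2 : ℝ)) (by norm_num)
      (by norm_num)).mul_const ‖y‖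
  simpa using hlim.const_sub y

theorem isBoundedBelow_rightMul_iff (hX : ¬ FiniteDimensional ℂ X) {B : X →L[ℂ] X} :
    IsBoundedBelow (rightMul B) ↔ rangeSpace B = ⊤ := by
  rw [isBoundedBelow_iff]
  constructor
  · rintro ⟨c, hc, h⟩
    obtain ⟨f₀, u, hu⟩ := exists_dual_eq_one hX
    have hu0 : u ≠ 0 := fun h => by simp [h] at hu
    refine LinearMap.range_eq_top.2 (surjective_of_transpose_bound hc fun f => ?_)
    have h1 := h (f.smulRight u)
    rw [rightMul_apply, smulRight_mul, ContinuousLinearMap.norm_smulRight_apply,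
      ContinuousLinearMap.norm_smulRight_apply, ← mul_assoc] at h1
    exact le_of_mul_le_mul_right h1 (norm_pos_iff.2 hu0)
  · intro h
    obtain ⟨C, hC, hs⟩ := B.exists_preimage_norm_le (LinearMap.range_eq_top.1 h)
    refine ⟨C⁻¹, by positivity, fun S => ?_⟩
    rw [inv_mul_le_iff₀ hC]
    refine S.opNorm_le_bound (by positivity) fun y => ?_
    obtain ⟨x, rfl, hx⟩ := hs y
    have h1 := (S * B).le_opNorm x
    have h2 := mul_le_mul_of_nonneg_left hx (norm_nonneg (S * B))
    rw [rightMul_apply]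
    change ‖(S * B) x‖ ≤ _
    linarith

theorem approxPointSpectrum_leftMul (hX : ¬ FiniteDimensional ℂ X) (A : X →L[ℂ] X) :
    approxPointSpectrum (leftMul A) = approxPointSpectrum A := by
  ext z
  change ¬ _ ↔ ¬ _
  rw [shift_leftMul, isBoundedBelow_leftMul_iff hX]

theorem approxPointSpectrum_rightMul (hX : ¬ FiniteDimensional ℂ X) (A : X →L[ℂ] X) :
    approxPointSpectrum (rightMul A) = surjectivitySpectrum A := by
  ext z
  change ¬ _ ↔ ¬ _
  rw [shift_rightMul, isBoundedBelow_rightMul_iff hX]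

end Multiplication

/-! ### Operators whose semi-Fredholm shifts are bounded below -/

section Collapse

variable {E : Type*} [NormedAddCommGroup E] [NormedSpace ℂ E] {T : E →L[ℂ] E}

theorem upperSemiFredholmSpectrum_eq
    (h : ∀ z, IsUpperSemiFredholm (shift T z) → IsBoundedBelow (shift T z)) :
    upperSemiFredholmSpectrum T = approxPointSpectrum T :=
  Set.ext fun z => not_congr ⟨h z, IsBoundedBelow.isUpperSemiFredholm⟩

theorem weylApproxSpectrum_eq
    (h : ∀ z, IsUpperSemiFredholm (shift T z) → IsBoundedBelow (shift T z)) :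
    weylApproxSpectrum T = approxPointSpectrum T :=
  Set.ext fun z => ⟨fun hz => hz.1, fun hz => ⟨hz, Or.inl fun hs => hz (h z hs)⟩⟩

theorem browderApproxSpectrum_eq
    (h : ∀ z, IsUpperSemiFredholm (shift T z) → IsBoundedBelow (shift T z)) :
    browderApproxSpectrum T = approxPointSpectrum T :=
  Set.ext fun z => ⟨fun hz => hz.1, fun hz => ⟨hz, Or.inl (by rwa [weylApproxSpectrum_eq h])⟩⟩

theorem satisfiesABrowder_of_isBoundedBelow [CompleteSpace E]
    (h : ∀ z, IsUpperSemiFredholm (shift T z) → IsBoundedBelow (shift T z)) :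
    SatisfiesABrowder T := by
  rw [SatisfiesABrowder, weylApproxSpectrum_eq h]
  refine Set.ext fun z => ⟨fun hz => ⟨hz, fun hp => hz (h z ?_)⟩, fun hz => hz.1⟩
  obtain ⟨n, hn⟩ := (mem_leftPoles_iff.1 hp.1).2
  exact (hn.isUpperSemiFredholm hp.2).1

end Collapse

/-! ### Multiplication operators on a Hilbert space -/

section Hilbert

variable {H : Type*} [NormedAddCommGroup H] [InnerProductSpace ℂ H] [CompleteSpace H]

/-- On a Hilbert space, if `R(C)` is closed then `R(L_C)` consists of all operators with range in
`R(C)`: such operators lift along the bijection of `N(C)ᗮ` onto `R(C)`. -/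
theorem isClosed_rangeSpace_leftMul {C : H →L[ℂ] H} (hC : IsClosed (rangeSpace C : Set H)) :
    IsClosed (rangeSpace (leftMul C) : Set (H →L[ℂ] H)) := by
  have : (rangeSpace (leftMul C) : Set (H →L[ℂ] H)) =
      ⋂ x : H, (fun S : H →L[ℂ] H => S x) ⁻¹' (rangeSpace C : Set H) := by
    ext S
    rw [Set.mem_iInter]
    constructor
    · rintro ⟨V, rfl⟩ x
      exact ⟨V x, rfl⟩
    · intro hS
      have hNcl : IsClosed (nullSpace C : Set H) := C.isClosed_ker
      have : CompleteSpace (nullSpace C) := hNcl.completeSpace_coe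
      have : CompleteSpace (rangeSpace C) := hC.completeSpace_coe
      let K := (nullSpace C)ᗮ
      let e : K →L[ℂ] rangeSpace C := (C.comp K.subtypeL).codRestrict _ fun x => ⟨x, rfl⟩
      have hinj : LinearMap.ker (e : K →ₗ[ℂ] rangeSpace C) = ⊥ := by
        rw [eq_bot_iff]
        intro x hx
        have h1 : (x : H) ∈ nullSpace C ⊓ (nullSpace C)ᗮ := ⟨congrArg Subtype.val hx, x.2⟩
        rw [Submodule.inf_orthogonal_eq_bot] at h1
        exact Subtype.ext h1
      have hsurj : LinearMap.range (e : K →ₗ[ℂ] rangeSpace C) = ⊤ := by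
        rw [LinearMap.range_eq_top]
        rintro ⟨_, x, rfl⟩
        obtain ⟨y, hy, k, hk, rfl⟩ := (nullSpace C).exists_add_mem_mem_orthogonal x
        have hy : C y = 0 := hy
        refine ⟨⟨k, hk⟩, Subtype.ext ?_⟩
        change C k = C (y + k)
        rw [map_add, hy, zero_add]
      let e' := ContinuousLinearEquiv.ofBijective e hinj hsurj
      let S' : H →L[ℂ] rangeSpace C := S.codRestrict _ hS
      refine ⟨K.subtypeL.comp ((e'.symm : rangeSpace C →L[ℂ] K).comp S'), ?_⟩
      ext x
      have h1 : e (e'.symm (S' x)) = S' x :=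
        ContinuousLinearEquiv.ofBijective_apply_symm_apply e hinj hsurj (S' x)
      exact congrArg Subtype.val h1
  rw [this]
  exact isClosed_iInter fun x => hC.preimage (by fun_prop)

theorem isLeftDrazinAt_leftMul_iff (hH : ¬ FiniteDimensional ℂ H) {B : H →L[ℂ] H} {n : ℕ} :
    IsLeftDrazinAt (leftMul B) n ↔ IsLeftDrazinAt B n := by
  have h : ∀ k, IsClosed (rangeSpace (leftMul B ^ k) : Set (H →L[ℂ] H)) ↔
      IsClosed (rangeSpace (B ^ k) : Set H) := fun k => by
    rw [leftMul_pow]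
    exact ⟨isClosed_rangeSpace_of_leftMul hH, isClosed_rangeSpace_leftMul⟩
  rw [IsLeftDrazinAt, IsLeftDrazinAt, h, h, nullSpace_leftMul_inf_eq_bot_iff hH]

theorem mem_rangeSpace_rightMul_iff {C S : H →L[ℂ] H} :
    S ∈ rangeSpace (rightMul C) ↔ star S ∈ rangeSpace (leftMul (star C)) := by
  constructor
  · rintro ⟨V, rfl⟩
    exact ⟨star V, (star_mul V C).symm⟩
  · rintro ⟨V, hV⟩
    have hV : star C * V = star S := hV
    refine ⟨star V, ?_⟩
    change star V * C = S
    rw [← star_star S, ← hV, star_mul, star_star]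

theorem mem_nullSpace_rightMul_iff {C S : H →L[ℂ] H} :
    S ∈ nullSpace (rightMul C) ↔ star S ∈ nullSpace (leftMul (star C)) := by
  rw [mem_nullSpace, mem_nullSpace, rightMul_apply, leftMul_apply, ← star_mul, star_eq_zero]

/-- The isometry `S ↦ S*` of `B(H)` carries `R_B` to `L_{B*}`. -/
theorem isLeftDrazinAt_rightMul_iff {B : H →L[ℂ] H} {n : ℕ} :
    IsLeftDrazinAt (rightMul B) n ↔ IsLeftDrazinAt (leftMul (star B)) n := by
  have h : ∀ k, IsClosed (rangeSpace (rightMul B ^ k) : Set (H →L[ℂ] H)) ↔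
      IsClosed (rangeSpace (leftMul (star B) ^ k) : Set (H →L[ℂ] H)) := fun k => by
    rw [rightMul_pow, leftMul_pow, ← star_pow]
    have e : (rangeSpace (rightMul (B ^ k)) : Set (H →L[ℂ] H)) =
        star ⁻¹' (rangeSpace (leftMul (star (B ^ k))) : Set (H →L[ℂ] H)) :=
      Set.ext fun S => mem_rangeSpace_rightMul_iff
    rw [e]
    refine ⟨fun hcl => ?_, fun hcl => hcl.preimage continuous_star⟩
    have := hcl.preimage (continuous_star (R := H →L[ℂ] H))
    rwa [← Set.preimage_comp, star_involutive.comp_self, Set.preimage_id] at this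
  rw [IsLeftDrazinAt, IsLeftDrazinAt, h, h]
  refine and_congr_right fun _ => and_congr_right fun _ => ?_
  rw [rightMul_pow, leftMul_pow, ← star_pow, eq_bot_iff, eq_bot_iff]
  constructor
  · rintro h S ⟨h1, h2⟩
    rw [← star_star S] at h1 h2
    exact star_eq_zero.1 (h ⟨mem_nullSpace_rightMul_iff.2 h1, mem_rangeSpace_rightMul_iff.2 h2⟩)
  · rintro h S ⟨h1, h2⟩
    exact star_eq_zero.1 (h ⟨mem_nullSpace_rightMul_iff.1 h1, mem_rangeSpace_rightMul_iff.1 h2⟩)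

theorem star_shift (A : H →L[ℂ] H) (z : ℂ) :
    star (shift A ((starRingEnd ℂ) z)) = shift (star A) z := by
  simp [shift]

end Hilbert

/-! ### Spectra of multiplication operators -/

section Spectra

variable {X : Type*} [NormedAddCommGroup X] [NormedSpace ℂ X]

theorem isBoundedBelow_shift_leftMul (hX : ¬ FiniteDimensional ℂ X) (A : X →L[ℂ] X) (z : ℂ)
    (h : IsUpperSemiFredholm (shift (leftMul A) z)) : IsBoundedBelow (shift (leftMul A) z) := by
  rw [shift_leftMul] at h ⊢
  exact ⟨nullSpace_leftMul_eq_bot hX (nullity_lt_top.1 h.2), h.1⟩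

theorem isBoundedBelow_shift_rightMul (hX : ¬ FiniteDimensional ℂ X) (A : X →L[ℂ] X) (z : ℂ)
    (h : IsUpperSemiFredholm (shift (rightMul A) z)) : IsBoundedBelow (shift (rightMul A) z) := by
  rw [shift_rightMul] at h ⊢
  exact ⟨nullSpace_rightMul_eq_bot hX (nullity_lt_top.1 h.2), h.1⟩

variable {H : Type*} [NormedAddCommGroup H] [InnerProductSpace ℂ H] [CompleteSpace H]

theorem leftPoles_leftMul (hH : ¬ FiniteDimensional ℂ H) (B : H →L[ℂ] H) :
    leftPoles (leftMul B) = leftPoles B := by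
  ext z
  simp only [mem_leftPoles_iff, approxPointSpectrum_leftMul hH, shift_leftMul,
    isLeftDrazinAt_leftMul_iff hH]

theorem conj_image_upperSemiBWeylSpectrum_rightMul (hH : ¬ FiniteDimensional ℂ H)
    (A : H →L[ℂ] H) :
    (starRingEnd ℂ) '' upperSemiBWeylSpectrum (rightMul A) =
      upperSemiBWeylSpectrum (leftMul (star A)) := by
  have hL := satisfiesABrowder_of_isBoundedBelow (isBoundedBelow_shift_leftMul hH (star A))
  have hR := satisfiesABrowder_of_isBoundedBelow (isBoundedBelow_shift_rightMul hH A)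
  have key : ∀ z, (starRingEnd ℂ) z ∈ upperSemiBWeylSpectrum (rightMul A) ↔
      z ∈ upperSemiBWeylSpectrum (leftMul (star A)) := fun z => by
    rw [hL.mem_upperSemiBWeylSpectrum_iff, hR.mem_upperSemiBWeylSpectrum_iff]
    simp only [shift_rightMul, shift_leftMul, isLeftDrazinAt_rightMul_iff, star_shift]
  ext z
  rw [← key]
  constructor
  · rintro ⟨w, hw, rfl⟩
    rwa [Complex.conj_conj]
  · exact fun hz => ⟨_, hz, Complex.conj_conj z⟩

end Spectra

end BrowderTheory

theorem theorem3p7 :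
    -- the claims for an infinite-dimensional complex Banach space
    (∀ (X : Type*) [NormedAddCommGroup X] [NormedSpace ℂ X] [CompleteSpace X],
      ¬ FiniteDimensional ℂ X → ∀ A : X →L[ℂ] X,
        (SatisfiesABrowder (leftMul A) ∧ SatisfiesABrowder (rightMul A) ∧
          (upperSemiFredholmSpectrum (leftMul A) = approxPointSpectrum A ∧
            weylApproxSpectrum (leftMul A) = approxPointSpectrum A ∧
            browderApproxSpectrum (leftMul A) = approxPointSpectrum A ∧
            approxPointSpectrum (leftMul A) = approxPointSpectrum A) ∧
          (upperSemiFredholmSpectrum (rightMul A) = surjectivitySpectrum A ∧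
            weylApproxSpectrum (rightMul A) = surjectivitySpectrum A ∧
            browderApproxSpectrum (rightMul A) = surjectivitySpectrum A ∧
            approxPointSpectrum (rightMul A) = surjectivitySpectrum A)) ∧
        (SatisfiesABrowder A ∧ leftPoles A = leftPoles (leftMul A) ↔
          upperSemiBWeylSpectrum A = upperSemiBWeylSpectrum (leftMul A))) ∧
    -- the claim for the adjoint on an infinite-dimensional complex Hilbert space
    (∀ (H : Type*) [NormedAddCommGroup H] [InnerProductSpace ℂ H] [CompleteSpace H],
      ¬ FiniteDimensional ℂ H → ∀ A : H →L[ℂ] H,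
        (SatisfiesABrowder (ContinuousLinearMap.adjoint A) ↔
          upperSemiBWeylSpectrum (ContinuousLinearMap.adjoint A) =
            (starRingEnd ℂ) '' upperSemiBWeylSpectrum (rightMul A))) := by
  refine ⟨fun X _ _ _ hX A => ?_, fun H _ _ _ hH A => ?_⟩
  · have hL := isBoundedBelow_shift_leftMul hX A
    have hR := isBoundedBelow_shift_rightMul hX A
    have hBL := satisfiesABrowder_of_isBoundedBelow hL
    have haL := approxPointSpectrum_leftMul hX A
    have haR := approxPointSpectrum_rightMul hX A
    refine ⟨⟨hBL, satisfiesABrowder_of_isBoundedBelow hR, ?_, ?_⟩,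
      satisfiesABrowder_and_leftPoles_eq_iff hBL haL⟩
    · rw [upperSemiFredholmSpectrum_eq hL, weylApproxSpectrum_eq hL, browderApproxSpectrum_eq hL]
      exact ⟨haL, haL, haL, haL⟩
    · rw [upperSemiFredholmSpectrum_eq hR, weylApproxSpectrum_eq hR, browderApproxSpectrum_eq hR]
      exact ⟨haR, haR, haR, haR⟩
  · rw [conj_image_upperSemiBWeylSpectrum_rightMul hH, ContinuousLinearMap.star_eq_adjoint,
      ← satisfiesABrowder_and_leftPoles_eq_iff
        (satisfiesABrowder_of_isBoundedBelow (isBoundedBelow_shift_leftMul hH _))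
        (approxPointSpectrum_leftMul hH _), leftPoles_leftMul hH]
    exact (and_iff_left rfl).symm
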